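/- Let $\sigma,T>0$ and let $W$ be a Wiener process with $W(0)=0$ and independent increments $W(t+\xi)-W(t)\sim\mathcal N(0,\sigma^2\xi)$. A three-region quantizer $\Phi$ consists of thresholds $\tau_-<\tau_+$ and center points $c_-,c_\emptyset,c_+\in\mathbb R$; it maps the regions $R_-=(-\infty,\tau_-]$, $R_\emptyset=(\tau_-,\tau_+)$, $R_+=[\tau_+,\infty)$ to $c_-,c_\emptyset,c_+$ respectively. At time $kT$ ($k\ge 1$) the variable $Y_k=W(kT)-\hat W_k$ is quantized, where $\hat W_1=0$ and $\hat W_{k+1}=\hat W_k+\Phi_k(Y_k)$; the symbol $n_k\in\{-,\emptyset,+\}$ of the region $R_{k n_k}$ of $\Phi_k$ containing $Y_k$ becomes known to the monitor. The quantizer $\Phi_k$ may be any function of $n_1,\dots,n_{k-1}$ (for instance the output of the Lloyd-Max algorithm for the current input density). Given $n_1,n_2,\dots$, the tracked densities are $$f_{Y_1}=f_X,\qquad f_{Q_k}(q)=\begin{cases}\dfrac{f_{Y_k}(q+c_{kn_k})}{\int_{R_{kn_k}}f_{Y_k}(y)\,dy},& q+c_{kn_k}\in R_{kn_k},\\ 0,&\text{otherwise,}\end{cases}\qquad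 f_{Y_{k+1}}=f_X*f_{Q_k},$$ where $f_X$ is the density of $\mathcal N(0,\sigma^2T)$. For a density $f$ and thresholds $\tau_-<\tau_+$, one pass of the Lloyd-Max iteration computes the conditional means $c_n=\int_{R_n}yf(y)\,dy\big/\int_{R_n}f(y)\,dy$ of the three regions, and replaces $(\tau_-,\tau_+)$ by $\big(\tfrac{c_-+c_\emptyset}{2},\tfrac{c_\emptyset+c_+}{2}\big)$. 1. If a probability density $g$ is log-concave, so is the density obtained from it by truncating it to a region (of positive mass) of a three-region quantizer, shifting it by the center point and normalizing, and so is $f_X*g$. 2. For every $k$ and all symbols $n_1,\dots,n_{k-1}$, the function $f=f_{Y_k}$ is an everywhere positive probability density with finite second moment, it is the density of $Y_k$ conditionally on the symbols sent in the first $k-1$ periods being $n_1,\dots,n_{k-1}$, and it is log-concave. 3. For each such $f$ there is exactly one quantizer $\Phi^*$ that minimizes the mean squared error $\int (y-\Phi(y))^2f(y)\,dy$ among all three-region quantizers $\Phi$. The Lloyd-Max iteration for $f$, started at the terciles $F^{-1}(1/3)<F^{-1}(2/3)$ of $f$, or at arbitrary thresholds $\tau_-<\tau_+$, keeps its thresholds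 strictly ordered, and its thresholds and center points converge to those of $\Phi^*$. In particular, for every tolerance $\varepsilon>0$ some pass of the iteration moves both thresholds by at most $\varepsilon$, so the algorithm terminates. -/

import Mathlib

open MeasureTheory ProbabilityTheory Filter Topology
open scoped NNReal Convolution

noncomputable section

namespace WienerTracking

/-- `W` is a Wiener process with variance parameter `σ ^ 2`: dividing it by `σ` gives a standard
Brownian motion (a.s. continuous paths, `W 0 = 0` a.s., independent increments
`W (t + ξ) - W t ∼ N(0, σ ^ 2 * ξ)`). -/
def IsWiener {Ω : Type*} [MeasurableSpace Ω] (σ : ℝ≥0) (W : ℝ≥0 → Ω → ℝ) (P : Measure Ω) : Prop :=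
  IsBrownianReal (fun t ω => (σ : ℝ)⁻¹ * W t ω) P

/-- The codebook `{-, ∅, +}`; `empty` stands for "nothing is transmitted". -/
inductive Symbol where
  | minus
  | empty
  | plus

/-- A three-region quantization function: two thresholds and three center points. -/
@[ext]
structure Quantizer where
  lo : ℝ
  hi : ℝ
  cMinus : ℝ
  cEmpty : ℝ
  cPlus : ℝ
  lo_lt_hi : lo < hi

/-- The regions `(-∞, lo]`, `(lo, hi)`, `[hi, ∞)`. -/
def Quantizer.region (Φ : Quantizer) : Symbol → Set ℝ
  | .minus => Set.Iic Φ.lo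
  | .empty => Set.Ioo Φ.lo Φ.hi
  | .plus => Set.Ici Φ.hi

/-- The center points of the three regions. -/
def Quantizer.center (Φ : Quantizer) : Symbol → ℝ
  | .minus => Φ.cMinus
  | .empty => Φ.cEmpty
  | .plus => Φ.cPlus

open Classical in
/-- The symbol of the region that contains the input `y`. -/
def Quantizer.symbol (Φ : Quantizer) (y : ℝ) : Symbol :=
  if y ≤ Φ.lo then .minus else if y < Φ.hi then .empty else .plus

/-- The value `Φ(y)`. -/
def Quantizer.apply (Φ : Quantizer) (y : ℝ) : ℝ :=
  Φ.center (Φ.symbol y)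

theorem Quantizer.mem_region_iff (Φ : Quantizer) (y : ℝ) (n : Symbol) :
    y ∈ Φ.region n ↔ Φ.symbol y = n := by
  have h := Φ.lo_lt_hi
  unfold Quantizer.symbol
  cases n <;> simp only [Quantizer.region, Set.mem_Iic, Set.mem_Ioo, Set.mem_Ici]
  all_goals split_ifs
  all_goals simp_all
  all_goals linarith

/-! ### The tracking scheme

A quantization strategy `Φ : List Symbol → Quantizer` selects the quantization function of a period
from the symbols sent in the earlier periods (latest symbol first), which both the source and the
monitor know. -/

/-- What the monitor has after `k` updates: the symbols sent so far, latest first, and its estimate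
of the process. The sample `k + 1` is taken at time `(k + 1) * T`, and the estimate is then raised
by the quantized difference between the sample and the current estimate. -/
def monitor {Ω : Type*} (W : ℝ≥0 → Ω → ℝ) (T : ℝ≥0) (Φ : List Symbol → Quantizer) :
    ℕ → Ω → List Symbol × ℝ
  | 0, _ => ([], 0)
  | k + 1, ω =>
      let s := monitor W T Φ k ω
      let y := W (((k : ℝ≥0) + 1) * T) ω - s.2
      ((Φ s.1).symbol y :: s.1, s.2 + (Φ s.1).apply y)

/-- The quantized variable of the sample `k + 1`, that is, `W((k+1)T) - Ŵ((k+1)T)`. -/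
def input {Ω : Type*} (W : ℝ≥0 → Ω → ℝ) (T : ℝ≥0) (Φ : List Symbol → Quantizer)
    (k : ℕ) (ω : Ω) : ℝ :=
  W (((k : ℝ≥0) + 1) * T) ω - (monitor W T Φ k ω).2

open Classical in
/-- Density of the quantization error, when an input with density `f` is quantized by `Φ` and falls
in the region of the symbol `n`: the truncated, shifted and normalized `f`. -/
def errorDensity (Φ : Quantizer) (n : Symbol) (f : ℝ → ℝ) (q : ℝ) : ℝ :=
  if q + Φ.center n ∈ Φ.region n then f (q + Φ.center n) / ∫ y in Φ.region n, f y else 0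

/-- The input density after the symbols `h` (latest first) have been sent, as the source and the
monitor track it: first `N(0, v)`, then the convolution of `N(0, v)` with the density of the
quantization error. -/
def inputDensity (v : ℝ≥0) (Φ : List Symbol → Quantizer) : List Symbol → ℝ → ℝ
  | [] => gaussianPDFReal 0 v
  | n :: h => gaussianPDFReal 0 v ⋆ errorDensity (Φ h) n (inputDensity v Φ h)

/-! ### Densities -/

/-- `f` is a probability density on the line. -/
def IsDensity (f : ℝ → ℝ) : Prop :=
  (∀ y, 0 ≤ f y) ∧ Integrable f ∧ ∫ y, f y = 1

/-- `f` is log-concave (with values `0` allowed). -/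
def LogConcave (f : ℝ → ℝ) : Prop :=
  (∀ y, 0 ≤ f y) ∧
    ∀ x y a b : ℝ, 0 ≤ a → 0 ≤ b → a + b = 1 → f x ^ a * f y ^ b ≤ f (a * x + b * y)

/-- The quantile function `F⁻¹(p) = inf {y | p ≤ F(y)}` of the density `f`. -/
def quantile (f : ℝ → ℝ) (p : ℝ) : ℝ :=
  sInf {y | p ≤ ∫ x in Set.Iic y, f x}

/-! ### Optimal quantizers and the Lloyd-Max iteration -/

/-- Expected distortion of `Φ` for an input with density `f`. -/
def mse (f : ℝ → ℝ) (Φ : Quantizer) : ℝ :=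
  ∫ y, (y - Φ.apply y) ^ 2 * f y

/-- `Φ` has the least expected distortion of all three-region quantizers. -/
def IsOptimal (f : ℝ → ℝ) (Φ : Quantizer) : Prop :=
  ∀ Ψ : Quantizer, mse f Φ ≤ mse f Ψ

/-- The center of mass of the region `s`. -/
def centroid (f : ℝ → ℝ) (s : Set ℝ) : ℝ :=
  (∫ y in s, y * f y) / ∫ y in s, f y

/-- One pass through the Lloyd-Max loop: new centers from the thresholds `τ`, then new thresholds
halfway between consecutive centers. -/
def lloydStep (f : ℝ → ℝ) (τ : ℝ × ℝ) : ℝ × ℝ :=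
  ((centroid f (Set.Iic τ.1) + centroid f (Set.Ioo τ.1 τ.2)) / 2,
    (centroid f (Set.Ioo τ.1 τ.2) + centroid f (Set.Ici τ.2)) / 2)

/-- The thresholds after `n` passes through the loop, from the initial thresholds `τ₀`. -/
def lloyd (f : ℝ → ℝ) (τ₀ : ℝ × ℝ) (n : ℕ) : ℝ × ℝ :=
  (lloydStep f)^[n] τ₀

/-- The Lloyd-Max iteration from `τ₀` converges to the quantizer `Φ`: it always has three regions,
and its thresholds and centers converge to those of `Φ`. -/
def LloydConverges (f : ℝ → ℝ) (τ₀ : ℝ × ℝ) (Φ : Quantizer) : Prop :=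
  (∀ n, (lloyd f τ₀ n).1 < (lloyd f τ₀ n).2) ∧
  Tendsto (lloyd f τ₀) atTop (𝓝 (Φ.lo, Φ.hi)) ∧
  Tendsto (fun n => centroid f (Set.Iic (lloyd f τ₀ n).1)) atTop (𝓝 Φ.cMinus) ∧
  Tendsto (fun n => centroid f (Set.Ioo (lloyd f τ₀ n).1 (lloyd f τ₀ n).2)) atTop (𝓝 Φ.cEmpty) ∧
  Tendsto (fun n => centroid f (Set.Ici (lloyd f τ₀ n).2)) atTop (𝓝 Φ.cPlus)

/-- The loop with tolerance `ε` stops: some pass moves both thresholds by at most `ε`. -/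
def LloydStops (f : ℝ → ℝ) (τ₀ : ℝ × ℝ) (ε : ℝ) : Prop :=
  ∃ n, |(lloyd f τ₀ n).1 - (lloyd f τ₀ (n + 1)).1| ≤ ε ∧
    |(lloyd f τ₀ n).2 - (lloyd f τ₀ (n + 1)).2| ≤ ε

end WienerTracking

end

/-!
The input densities are log-concave because log-concavity survives each operation of the scheme.
For truncation, shift and normalization this is immediate. For the convolution with a log-concave
kernel `k` log-concavity is used in its two-point form `f x * f (y + d) ≤ f (x + d) * f y`, for
`x ≤ y` and `0 < d`: the difference of the two sides for `k ⋆ g` is half the integral of a product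
of two determinants of equal sign, one from `k` and one from `g`. If `k` is Gaussian, then its
determinant is strictly signed, and the inequality for `k ⋆ g` is strict
(`IsRegularDensity.strictLogConcave_convolution`). Strictness is what makes the rest work.

That the tracked density is the conditional density of the input follows by induction on the symbols
sent: the next increment of the Wiener process is independent of its past, which determines the
symbols and the current input, so given the symbols the next input is a sum of two independent
variables, the increment and the quantization error (`IsWiener.map_input_cond`).

For the Lloyd-Max iteration, two facts about centroids suffice. Moving a boundary of a region moves
the centroid in the same direction, so the Lloyd-Max map `L` on threshold pairs is monotone for the
coordinatewise order. Translating a region by `d > 0` moves its centroid by less than `d`, by strict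
log-concavity (`IsRegularDensity.centroid_preimage_sub_lt`), so `L (τ + (d, d)) < L τ + (d, d)` in
both coordinates. Together they say that `L` strictly decreases the supremum distance of distinct
threshold pairs (`IsRegularDensity.dist_lloydStep_lt`). Hence a fixed point is unique; it exists
because `L` has a point below its image and maps some larger point below itself; and since
the gap between the thresholds of an orbit stays bounded away from `0`, every orbit converges to the
fixed point by compactness (`IsRegularDensity.tendsto_lloyd`). A pass does not increase the mean
squared error, so the fixed point, as the limit of the iteration from the thresholds of an arbitrary
competitor, is optimal; conversely the thresholds of an optimal quantizer form a fixed point and its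
center points are centroids.
-/

noncomputable section

namespace WienerTracking

/-! ### Strictly log-concave densities and their centroids -/

/-- Strict log-concavity of a positive function, in the form that the ratio `f (x + d) / f x` is
strictly decreasing in `x` for every `d > 0`. -/
def StrictLogConcave (f : ℝ → ℝ) : Prop :=
  ∀ ⦃x y d : ℝ⦄, x < y → 0 < d → f x * f (y + d) < f (x + d) * f y

/-- The properties of the input densities on which the analysis of the Lloyd-Max iteration rests. -/
structure IsRegularDensity (f : ℝ → ℝ) : Prop where
  isDensity : IsDensity f
  pos : ∀ y, 0 < f y
  continuous : Continuous f
  integrable_sq_mul : Integrable (fun y => y ^ 2 * f y)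
  strictLogConcave : StrictLogConcave f

theorem setIntegral_pos_of_pos_off_point {g : ℝ → ℝ} {s : Set ℝ} (c : ℝ) (hg : IntegrableOn g s)
    (hs : MeasurableSet s) (hs0 : volume s ≠ 0) (hpos : ∀ y ∈ s, y ≠ c → 0 < g y) :
    0 < ∫ y in s, g y := by
  have hae : ∀ᵐ y ∂(volume.restrict s), 0 < g y := by
    have hc : ∀ᵐ y : ℝ ∂(volume.restrict s), y ≠ c :=
      ae_restrict_of_ae (compl_mem_ae_iff.2 (measure_singleton c))
    filter_upwards [hc, ae_restrict_mem hs] with y h1 h2 using hpos y h2 h1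
  rw [integral_pos_iff_support_of_nonneg_ae (hae.mono fun _ h => h.le) hg]
  refine pos_iff_ne_zero.2 fun h0 => hs0 ?_
  have hfalse : ∀ᵐ y ∂(volume.restrict s), False := by
    filter_upwards [hae, measure_eq_zero_iff_ae_notMem.1 h0] with y h1 h2
    exact h2 h1.ne'
  rw [← Measure.restrict_eq_zero, ← ae_eq_bot]
  exact eventually_false_iff_eq_bot.1 hfalse

namespace IsRegularDensity

variable {f : ℝ → ℝ} {s t : Set ℝ} {a b c d : ℝ}

theorem integrable (hf : IsRegularDensity f) : Integrable f := hf.isDensity.2.1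

theorem integrable_mul (hf : IsRegularDensity f) : Integrable (fun y => y * f y) := by
  refine (hf.integrable.add hf.integrable_sq_mul).mono'
    (continuous_id.mul hf.continuous).aestronglyMeasurable (.of_forall fun y => ?_)
  have h := (hf.pos y).le
  rw [Real.norm_eq_abs, abs_mul, abs_of_nonneg h, Pi.add_apply]
  have : |y| ≤ 1 + y ^ 2 := by nlinarith [sq_abs y, sq_nonneg (|y| - 1), abs_nonneg y]
  nlinarith

theorem integrable_sub_mul (hf : IsRegularDensity f) (c : ℝ) :
    Integrable (fun y => (y - c) * f y) := by
  refine (hf.integrable_mul.sub (hf.integrable.const_mul c)).congr (.of_forall fun y => ?_)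
  simp only [Pi.sub_apply, sub_mul]

theorem integrable_sub_sq_mul (hf : IsRegularDensity f) (c : ℝ) :
    Integrable (fun y => (y - c) ^ 2 * f y) := by
  have := (hf.integrable_sq_mul.sub (hf.integrable_mul.const_mul (2 * c))).add
    (hf.integrable.const_mul (c ^ 2))
  refine this.congr (.of_forall fun y => ?_)
  simp only [Pi.add_apply, Pi.sub_apply]
  ring

theorem mass_pos (hf : IsRegularDensity f) (hs : MeasurableSet s) (hs0 : volume s ≠ 0) :
    0 < ∫ y in s, f y :=
  setIntegral_pos_of_pos_off_point 0 hf.integrable.integrableOn hs hs0 fun y _ _ => hf.pos y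

theorem setIntegral_sub_mul (hf : IsRegularDensity f) (s : Set ℝ) (c : ℝ) :
    ∫ y in s, (y - c) * f y = (∫ y in s, y * f y) - c * ∫ y in s, f y := by
  simp_rw [sub_mul]
  rw [integral_sub hf.integrable_mul.integrableOn (hf.integrable.const_mul c).integrableOn,
    integral_const_mul]

theorem lt_centroid_iff (hf : IsRegularDensity f) (hs : MeasurableSet s) (hs0 : volume s ≠ 0) :
    c < centroid f s ↔ 0 < ∫ y in s, (y - c) * f y := by
  rw [hf.setIntegral_sub_mul, centroid, lt_div_iff₀ (hf.mass_pos hs hs0), sub_pos]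

theorem centroid_lt_iff (hf : IsRegularDensity f) (hs : MeasurableSet s) (hs0 : volume s ≠ 0) :
    centroid f s < c ↔ ∫ y in s, (y - c) * f y < 0 := by
  rw [hf.setIntegral_sub_mul, centroid, div_lt_iff₀ (hf.mass_pos hs hs0), sub_neg]

theorem setIntegral_sub_centroid_mul (hf : IsRegularDensity f) (hs : MeasurableSet s)
    (hs0 : volume s ≠ 0) : ∫ y in s, (y - centroid f s) * f y = 0 := by
  rw [hf.setIntegral_sub_mul, centroid, div_mul_cancel₀ _ (hf.mass_pos hs hs0).ne', sub_self]

theorem lt_centroid_of_subset_Ici (hf : IsRegularDensity f) (hs : MeasurableSet s)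
    (hs0 : volume s ≠ 0) (h : s ⊆ Set.Ici a) : a < centroid f s := by
  rw [hf.lt_centroid_iff hs hs0]
  exact setIntegral_pos_of_pos_off_point a (hf.integrable_sub_mul a).integrableOn hs hs0
    fun y hy hya => mul_pos (sub_pos.2 (lt_of_le_of_ne (h hy) hya.symm)) (hf.pos y)

theorem centroid_lt_of_subset_Iic (hf : IsRegularDensity f) (hs : MeasurableSet s)
    (hs0 : volume s ≠ 0) (h : s ⊆ Set.Iic b) : centroid f s < b := by
  rw [hf.centroid_lt_iff hs hs0, ← neg_pos, ← integral_neg]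
  exact setIntegral_pos_of_pos_off_point b (hf.integrable_sub_mul b).neg.integrableOn hs hs0
    fun y hy hyb => by nlinarith [hf.pos y, lt_of_le_of_ne (h hy) hyb]

theorem centroid_lt_centroid_union (hf : IsRegularDensity f) (hs : MeasurableSet s)
    (ht : MeasurableSet t) (hs0 : volume s ≠ 0) (ht0 : volume t ≠ 0) (hst : Disjoint s t)
    (hsb : s ⊆ Set.Iic b) (htb : t ⊆ Set.Ici b) : centroid f s < centroid f (s ∪ t) := by
  have hu0 : volume (s ∪ t) ≠ 0 := fun h => hs0 (measure_mono_null Set.subset_union_left h)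
  have hb := hf.centroid_lt_of_subset_Iic hs hs0 hsb
  rw [hf.lt_centroid_iff (hs.union ht) hu0, setIntegral_union hst ht
    (hf.integrable_sub_mul _).integrableOn (hf.integrable_sub_mul _).integrableOn,
    hf.setIntegral_sub_centroid_mul hs hs0, zero_add, ← hf.lt_centroid_iff ht ht0]
  exact hb.trans (hf.lt_centroid_of_subset_Ici ht ht0 htb)

theorem centroid_union_lt_centroid (hf : IsRegularDensity f) (hs : MeasurableSet s)
    (ht : MeasurableSet t) (hs0 : volume s ≠ 0) (ht0 : volume t ≠ 0) (hst : Disjoint s t)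
    (hsb : s ⊆ Set.Iic b) (htb : t ⊆ Set.Ici b) : centroid f (s ∪ t) < centroid f t := by
  have hu0 : volume (s ∪ t) ≠ 0 := fun h => hs0 (measure_mono_null Set.subset_union_left h)
  have hb := hf.lt_centroid_of_subset_Ici ht ht0 htb
  rw [hf.centroid_lt_iff (hs.union ht) hu0, setIntegral_union hst ht
    (hf.integrable_sub_mul _).integrableOn (hf.integrable_sub_mul _).integrableOn,
    hf.setIntegral_sub_centroid_mul ht ht0, add_zero, ← hf.centroid_lt_iff hs hs0]
  exact (hf.centroid_lt_of_subset_Iic hs hs0 hsb).trans hb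

/-- The point at which strict log-concavity enters: translating a region to the right by `d` moves
its centroid by less than `d`. -/
theorem centroid_preimage_sub_lt (hf : IsRegularDensity f) (hs : MeasurableSet s)
    (hs0 : volume s ≠ 0) (hd : 0 < d) :
    centroid f ((fun y => y - d) ⁻¹' s) < centroid f s + d := by
  set c := centroid f s with hc
  have hmp : MeasurePreserving (fun y : ℝ => y - d) := measurePreserving_sub_right volume d
  have hemb : MeasurableEmbedding (fun y : ℝ => y - d) :=
    (MeasurableEquiv.subRight d).measurableEmbedding
  have hvol : volume ((fun y => y - d) ⁻¹' s) ≠ 0 := by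
    rwa [hmp.measure_preimage hs.nullMeasurableSet]
  have hint : Integrable (fun x => (x - c) * f (x + d)) := by
    have := (hf.integrable_sub_mul (c + d)).comp_add_right d
    refine this.congr (.of_forall fun x => ?_)
    simp only []
    ring
  have heq : ∫ y in (fun y => y - d) ⁻¹' s, (y - (c + d)) * f y =
      ∫ x in s, (x - c) * f (x + d) := by
    rw [← hmp.setIntegral_preimage_emb hemb (fun x => (x - c) * f (x + d))]
    refine integral_congr_ae (.of_forall fun y => ?_)
    simp only [sub_add_cancel]
    ring
  rw [hf.centroid_lt_iff (hmp.measurable hs) hvol, heq]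
  -- Subtracting a multiple of `∫ (x - c) f x = 0` makes the integrand single-signed.
  set r := f (c + d) / f c with hr
  have h0 := hf.setIntegral_sub_centroid_mul hs hs0
  have hpos : 0 < ∫ x in s, (r * ((x - c) * f x) - (x - c) * f (x + d)) := by
    refine setIntegral_pos_of_pos_off_point c
      (((hf.integrable_sub_mul c).const_mul r).sub hint).integrableOn hs hs0 fun x _ hx => ?_
    have hrc : r * f c = f (c + d) := div_mul_cancel₀ _ (hf.pos c).ne'
    rw [show r * ((x - c) * f x) - (x - c) * f (x + d) = (x - c) * (r * f x - f (x + d)) by ring]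
    rcases lt_or_gt_of_ne hx with h | h
    · have := hf.strictLogConcave h hd
      rw [← hrc] at this
      have : r * f x < f (x + d) := lt_of_mul_lt_mul_right (a := f c) (by linarith) (hf.pos c).le
      exact mul_pos_of_neg_of_neg (by linarith) (by linarith)
    · have := hf.strictLogConcave h hd
      rw [← hrc] at this
      have : f (x + d) < r * f x := lt_of_mul_lt_mul_right (a := f c) (by linarith) (hf.pos c).le
      exact mul_pos (by linarith) (by linarith)
  rw [integral_sub ((hf.integrable_sub_mul c).const_mul r).integrableOn hint.integrableOn,
    integral_const_mul, h0] at hpos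
  linarith

/-! ### Monotonicity of the centroids of half-lines and intervals -/

theorem centroid_Iic_lt (hf : IsRegularDensity f) (b : ℝ) : centroid f (Set.Iic b) < b :=
  hf.centroid_lt_of_subset_Iic measurableSet_Iic (by simp) subset_rfl

theorem lt_centroid_Ici (hf : IsRegularDensity f) (a : ℝ) : a < centroid f (Set.Ici a) :=
  hf.lt_centroid_of_subset_Ici measurableSet_Ici (by simp) subset_rfl

theorem lt_centroid_Ioo (hf : IsRegularDensity f) (h : a < b) : a < centroid f (Set.Ioo a b) :=
  hf.lt_centroid_of_subset_Ici measurableSet_Ioo (by simpa using h) fun _ hx => hx.1.le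

theorem centroid_Ioo_lt (hf : IsRegularDensity f) (h : a < b) : centroid f (Set.Ioo a b) < b :=
  hf.centroid_lt_of_subset_Iic measurableSet_Ioo (by simpa using h) fun _ hx => hx.2.le

theorem centroid_Iic_strictMono (hf : IsRegularDensity f) :
    StrictMono fun b => centroid f (Set.Iic b) := fun a b h => by
  have := hf.centroid_lt_centroid_union measurableSet_Iic (measurableSet_Ioc (a := a) (b := b))
    (by simp) (by simpa using h) (Set.Iic_disjoint_Ioc le_rfl) subset_rfl fun _ hx => hx.1.le
  rwa [Set.Iic_union_Ioc_eq_Iic h.le] at this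

theorem centroid_Ici_strictMono (hf : IsRegularDensity f) :
    StrictMono fun a => centroid f (Set.Ici a) := fun a b h => by
  have := hf.centroid_union_lt_centroid (measurableSet_Ico (a := a) (b := b)) measurableSet_Ici
    (by simpa using h) (by simp)
    (Set.disjoint_left.2 fun x hx hx' => absurd hx.2 (not_lt.2 hx')) (fun _ hx => hx.2.le)
    subset_rfl
  rwa [Set.Ico_union_Ici_eq_Ici h.le] at this

theorem centroid_Ioo_mono_right (hf : IsRegularDensity f) {b' : ℝ} (hab : a < b) (h : b ≤ b') :
    centroid f (Set.Ioo a b) ≤ centroid f (Set.Ioo a b') := by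
  rcases h.eq_or_lt with rfl | h
  · rfl
  have := hf.centroid_lt_centroid_union (measurableSet_Ioo (a := a) (b := b))
    (measurableSet_Ico (a := b) (b := b')) (by simpa using hab) (by simpa using h)
    (Set.disjoint_left.2 fun x hx hx' => absurd hx.2 (not_lt.2 hx'.1)) (fun _ hx => hx.2.le)
    fun _ hx => hx.1
  rw [Set.Ioo_union_Ico_eq_Ioo hab h.le] at this
  exact this.le

theorem centroid_Ioo_mono_left (hf : IsRegularDensity f) {a' : ℝ} (hab : a' < b) (h : a ≤ a') :
    centroid f (Set.Ioo a b) ≤ centroid f (Set.Ioo a' b) := by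
  rcases h.eq_or_lt with rfl | h
  · rfl
  have := hf.centroid_union_lt_centroid (measurableSet_Ioc (a := a) (b := a'))
    (measurableSet_Ioo (a := a') (b := b)) (by simpa using h) (by simpa using hab)
    (Set.disjoint_left.2 fun x hx hx' => absurd hx'.1 (not_lt.2 hx.2)) (fun _ hx => hx.2)
    fun _ hx => hx.1.le
  rw [Set.Ioc_union_Ioo_eq_Ioo h.le hab] at this
  exact this.le

theorem centroid_Iic_lt_centroid_Ioo (hf : IsRegularDensity f) (h : a < b) :
    centroid f (Set.Iic b) < centroid f (Set.Ioo a b) := by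
  have := hf.centroid_union_lt_centroid (measurableSet_Iic (a := a))
    (measurableSet_Ioo (a := a) (b := b)) (by simp) (by simpa using h)
    (Set.disjoint_left.2 fun x hx hx' => absurd hx'.1 (not_lt.2 hx)) subset_rfl fun _ hx => hx.1.le
  rw [Set.Iic_union_Ioo_eq_Iio h] at this
  rwa [centroid, integral_Iic_eq_integral_Iio, integral_Iic_eq_integral_Iio, ← centroid]

theorem centroid_Ioo_lt_centroid_Ici (hf : IsRegularDensity f) (h : a < b) :
    centroid f (Set.Ioo a b) < centroid f (Set.Ici a) := by
  have := hf.centroid_lt_centroid_union (measurableSet_Ioo (a := a) (b := b))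
    (measurableSet_Ici (a := b)) (by simpa using h) (by simp)
    (Set.disjoint_left.2 fun x hx hx' => absurd hx.2 (not_lt.2 hx')) (fun _ hx => hx.2.le)
    subset_rfl
  rw [Set.Ioo_union_Ici_eq_Ioi h] at this
  rwa [centroid, centroid, integral_Ici_eq_integral_Ioi, integral_Ici_eq_integral_Ioi, ← centroid,
    ← centroid]

theorem centroid_Iic_lt_centroid_univ (hf : IsRegularDensity f) (b : ℝ) :
    centroid f (Set.Iic b) < centroid f Set.univ := by
  have := hf.centroid_lt_centroid_union (measurableSet_Iic (a := b)) (measurableSet_Ioi (a := b))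
    (by simp) (by simp) (Set.Iic_disjoint_Ioi le_rfl) subset_rfl
    fun _ hx => Set.mem_Ici.2 (le_of_lt (Set.mem_Ioi.1 hx))
  rwa [Set.Iic_union_Ioi] at this

theorem centroid_univ_lt_centroid_Ici (hf : IsRegularDensity f) (a : ℝ) :
    centroid f Set.univ < centroid f (Set.Ici a) := by
  have := hf.centroid_union_lt_centroid (measurableSet_Iio (a := a)) (measurableSet_Ici (a := a))
    (by simp) (by simp)
    (Set.disjoint_left.2 fun x hx hx' => absurd (Set.mem_Iio.1 hx) (not_lt.2 (Set.mem_Ici.1 hx')))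
    (fun _ hx => Set.mem_Iic.2 (le_of_lt (Set.mem_Iio.1 hx))) subset_rfl
  rwa [Set.Iio_union_Ici] at this

theorem centroid_Iic_add_lt (hf : IsRegularDensity f) (b : ℝ) (hd : 0 < d) :
    centroid f (Set.Iic (b + d)) < centroid f (Set.Iic b) + d := by
  simpa using hf.centroid_preimage_sub_lt (measurableSet_Iic (a := b)) (by simp) hd

theorem centroid_Ici_add_lt (hf : IsRegularDensity f) (a : ℝ) (hd : 0 < d) :
    centroid f (Set.Ici (a + d)) < centroid f (Set.Ici a) + d := by
  simpa using hf.centroid_preimage_sub_lt (measurableSet_Ici (a := a)) (by simp) hd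

theorem centroid_Ioo_add_lt (hf : IsRegularDensity f) (h : a < b) (hd : 0 < d) :
    centroid f (Set.Ioo (a + d) (b + d)) < centroid f (Set.Ioo a b) + d := by
  simpa using hf.centroid_preimage_sub_lt (measurableSet_Ioo (a := a) (b := b))
    (by simpa using h) hd

/-- The distance from a threshold to the centroid above it decreases in the threshold. -/
theorem centroid_Ici_sub_antitone (hf : IsRegularDensity f) :
    Antitone fun a => centroid f (Set.Ici a) - a := fun a b h => by
  rcases h.eq_or_lt with rfl | h
  · rfl
  have := hf.centroid_Ici_add_lt a (sub_pos.2 h)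
  rw [add_sub_cancel] at this
  simp only []
  linarith

/-- The distance from a threshold to the centroid below it increases with the threshold. -/
theorem sub_centroid_Iic_monotone (hf : IsRegularDensity f) :
    Monotone fun b => b - centroid f (Set.Iic b) := fun a b h => by
  rcases h.eq_or_lt with rfl | h
  · rfl
  have := hf.centroid_Iic_add_lt a (sub_pos.2 h)
  rw [add_sub_cancel] at this
  simp only []
  linarith

end IsRegularDensity

/-! ### The Lloyd-Max map is monotone and strictly contracting -/

theorem le_add_dist (τ τ' : ℝ × ℝ) : τ ≤ τ' + (dist τ τ', dist τ τ') := by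
  have h1 := (le_abs_self (τ.1 - τ'.1)).trans (le_max_left _ |τ.2 - τ'.2|)
  have h2 := (le_abs_self (τ.2 - τ'.2)).trans (le_max_right |τ.1 - τ'.1| _)
  rw [Prod.dist_eq, Real.dist_eq, Real.dist_eq]
  constructor <;> simp only [Prod.fst_add, Prod.snd_add] <;> linarith

theorem isOpen_setOf_fst_lt_snd : IsOpen {τ : ℝ × ℝ | τ.1 < τ.2} :=
  isOpen_lt continuous_fst continuous_snd

theorem continuousAt_of_le_add_dist {g : ℝ × ℝ → ℝ} {τ : ℝ × ℝ}
    (hg : ∀ τ τ' : ℝ × ℝ, τ.1 < τ.2 → τ'.1 < τ'.2 → g τ ≤ g τ' + dist τ τ') (h : τ.1 < τ.2) :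
    ContinuousAt g τ := by
  rw [Metric.continuousAt_iff]
  intro ε hε
  obtain ⟨δ, hδ, hball⟩ := Metric.isOpen_iff.1 isOpen_setOf_fst_lt_snd τ h
  refine ⟨min ε δ, lt_min hε hδ, fun {x} hx => ?_⟩
  have hx' : x.1 < x.2 := hball (hx.trans_le (min_le_right _ _))
  have h1 := hg x τ hx' h
  have h2 := hg τ x h hx'
  rw [dist_comm τ x] at h2
  rw [Real.dist_eq, abs_lt]
  have := hx.trans_le (min_le_left _ _)
  constructor <;> linarith

theorem lloyd_succ (f : ℝ → ℝ) (τ : ℝ × ℝ) (n : ℕ) :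
    lloyd f τ (n + 1) = lloydStep f (lloyd f τ n) :=
  Function.iterate_succ_apply' _ _ _

namespace IsRegularDensity

variable {f : ℝ → ℝ} {τ τ' : ℝ × ℝ} {d : ℝ}

theorem lloydStep_fst_lt_snd (hf : IsRegularDensity f) (h : τ.1 < τ.2) :
    (lloydStep f τ).1 < (lloydStep f τ).2 := by
  have h1 := hf.centroid_Iic_lt τ.1
  have h2 := hf.lt_centroid_Ici τ.2
  simp only [lloydStep]
  linarith

theorem centroid_Ioo_mono (hf : IsRegularDensity f) (h : τ.1 < τ.2) (h' : τ'.1 < τ'.2)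
    (hle : τ ≤ τ') : centroid f (Set.Ioo τ.1 τ.2) ≤ centroid f (Set.Ioo τ'.1 τ'.2) :=
  (hf.centroid_Ioo_mono_right h hle.2).trans (hf.centroid_Ioo_mono_left h' hle.1)

theorem lloydStep_mono (hf : IsRegularDensity f) (h : τ.1 < τ.2) (h' : τ'.1 < τ'.2) (hle : τ ≤ τ') :
    lloydStep f τ ≤ lloydStep f τ' := by
  have h1 : centroid f (Set.Iic τ.1) ≤ centroid f (Set.Iic τ'.1) :=
    hf.centroid_Iic_strictMono.monotone hle.1
  have h2 : centroid f (Set.Ici τ.2) ≤ centroid f (Set.Ici τ'.2) :=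
    hf.centroid_Ici_strictMono.monotone hle.2
  have h3 := hf.centroid_Ioo_mono h h' hle
  constructor <;> simp only [lloydStep] <;> linarith

theorem lloydStep_add_lt (hf : IsRegularDensity f) (h : τ.1 < τ.2) (hd : 0 < d) :
    (lloydStep f (τ + (d, d))).1 < (lloydStep f τ).1 + d ∧
      (lloydStep f (τ + (d, d))).2 < (lloydStep f τ).2 + d := by
  have h1 := hf.centroid_Iic_add_lt τ.1 hd
  have h2 := hf.centroid_Ici_add_lt τ.2 hd
  have h3 := hf.centroid_Ioo_add_lt h hd
  constructor <;> simp only [lloydStep, Prod.fst_add, Prod.snd_add] <;> linarith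

/-- A monotone map that shrinks translations along the diagonal shrinks the supremum distance. -/
theorem dist_lloydStep_lt (hf : IsRegularDensity f) (h : τ.1 < τ.2) (h' : τ'.1 < τ'.2)
    (hne : τ ≠ τ') : dist (lloydStep f τ) (lloydStep f τ') < dist τ τ' := by
  have hd : 0 < dist τ τ' := dist_pos.2 hne
  have key : ∀ {u v : ℝ × ℝ}, u.1 < u.2 → v.1 < v.2 → dist u v = dist τ τ' →
      (lloydStep f u).1 < (lloydStep f v).1 + dist τ τ' ∧
        (lloydStep f u).2 < (lloydStep f v).2 + dist τ τ' := fun {u v} hu hv huv => by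
    have hmono := hf.lloydStep_mono hu (by simpa using hv) (le_add_dist u v)
    rw [huv] at hmono
    have := hf.lloydStep_add_lt hv hd
    exact ⟨hmono.1.trans_lt this.1, hmono.2.trans_lt this.2⟩
  have h1 := key h h' rfl
  have h2 := key h' h (dist_comm _ _)
  rw [Prod.dist_eq, Real.dist_eq, Real.dist_eq, max_lt_iff, abs_lt, abs_lt]
  constructor <;> constructor <;> linarith [h1.1, h1.2, h2.1, h2.2]

theorem dist_lloydStep_le (hf : IsRegularDensity f) (h : τ.1 < τ.2) (h' : τ'.1 < τ'.2) :
    dist (lloydStep f τ) (lloydStep f τ') ≤ dist τ τ' := by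
  rcases eq_or_ne τ τ' with rfl | hne
  · simp
  · exact (hf.dist_lloydStep_lt h h' hne).le

theorem continuousAt_centroid_Iic (hf : IsRegularDensity f) (h : τ.1 < τ.2) :
    ContinuousAt (fun τ : ℝ × ℝ => centroid f (Set.Iic τ.1)) τ := by
  refine continuousAt_of_le_add_dist (fun u v hu hv => ?_) h
  rcases eq_or_ne u v with rfl | hne
  · simp
  exact (hf.centroid_Iic_strictMono.monotone (le_add_dist u v).1).trans
    (hf.centroid_Iic_add_lt v.1 (dist_pos.2 hne)).le

theorem continuousAt_centroid_Ici (hf : IsRegularDensity f) (h : τ.1 < τ.2) :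
    ContinuousAt (fun τ : ℝ × ℝ => centroid f (Set.Ici τ.2)) τ := by
  refine continuousAt_of_le_add_dist (fun u v hu hv => ?_) h
  rcases eq_or_ne u v with rfl | hne
  · simp
  exact (hf.centroid_Ici_strictMono.monotone (le_add_dist u v).2).trans
    (hf.centroid_Ici_add_lt v.2 (dist_pos.2 hne)).le

theorem continuousAt_centroid_Ioo (hf : IsRegularDensity f) (h : τ.1 < τ.2) :
    ContinuousAt (fun τ : ℝ × ℝ => centroid f (Set.Ioo τ.1 τ.2)) τ := by
  refine continuousAt_of_le_add_dist (fun u v hu hv => ?_) h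
  rcases eq_or_ne u v with rfl | hne
  · simp
  exact (hf.centroid_Ioo_mono hu (by simpa using hv) (le_add_dist u v)).trans
    (hf.centroid_Ioo_add_lt hv (dist_pos.2 hne)).le

theorem continuousAt_lloydStep (hf : IsRegularDensity f) (h : τ.1 < τ.2) :
    ContinuousAt (lloydStep f) τ :=
  (((hf.continuousAt_centroid_Iic h).add (hf.continuousAt_centroid_Ioo h)).div_const 2).prodMk
    (((hf.continuousAt_centroid_Ioo h).add (hf.continuousAt_centroid_Ici h)).div_const 2)

theorem lloyd_fst_lt_snd (hf : IsRegularDensity f) (h : τ.1 < τ.2) (n : ℕ) :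
    (lloyd f τ n).1 < (lloyd f τ n).2 := by
  induction n with
  | zero => exact h
  | succ n ih => rw [lloyd_succ]; exact hf.lloydStep_fst_lt_snd ih

/-- On bounded sets, the thresholds after a pass stay uniformly apart. -/
theorem gap_le_lloydStep (hf : IsRegularDensity f) {M : ℝ} (h : τ.1 < τ.2) (hM : τ.2 ≤ M) :
    (centroid f (Set.Ici M) - M) / 2 ≤ (lloydStep f τ).2 - (lloydStep f τ).1 := by
  have h1 := hf.centroid_Iic_lt τ.1
  have h2 := hf.centroid_Ici_sub_antitone hM
  simp only [] at h2
  simp only [lloydStep]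
  linarith

theorem fst_lt_snd_of_tendsto_lloyd (hf : IsRegularDensity f) {M : ℝ} {z : ℝ × ℝ} {φ : ℕ → ℕ}
    (h : τ.1 < τ.2) (hM : ∀ n, (lloyd f τ n).2 ≤ M)
    (hφ : Tendsto (fun n => lloyd f τ (φ n + 1)) atTop (𝓝 z)) : z.1 < z.2 := by
  have hgap : 0 < (centroid f (Set.Ici M) - M) / 2 := by linarith [hf.lt_centroid_Ici M]
  have hlim : Tendsto (fun n => (lloyd f τ (φ n + 1)).2 - (lloyd f τ (φ n + 1)).1) atTop
      (𝓝 (z.2 - z.1)) :=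
    ((continuous_snd.tendsto z).comp hφ).sub ((continuous_fst.tendsto z).comp hφ)
  have := ge_of_tendsto' hlim fun n => by
    rw [lloyd_succ]
    exact hf.gap_le_lloydStep (hf.lloyd_fst_lt_snd h _) (hM _)
  linarith

/-! ### Existence of a fixed point, and convergence to it -/

/-- Below a low enough `p₂` and a still lower `p₁`, the distances from the thresholds to the
centroids below them are at most the constant `K`, and those to the centroids above them are at
least `K`. -/
theorem exists_le_lloydStep (hf : IsRegularDensity f) :
    ∃ p : ℝ × ℝ, p.1 < p.2 ∧ p.2 ≤ 0 ∧ p ≤ lloydStep f p := by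
  set K := 0 - centroid f (Set.Iic 0)
  set p₂ := min 0 (centroid f Set.univ - K)
  set p₁ := min (p₂ - 1) (centroid f (Set.Iic p₂) - K)
  have h2 : p₂ ≤ 0 := min_le_left _ _
  have h2' : p₂ ≤ centroid f Set.univ - K := min_le_right _ _
  have h1 : p₁ ≤ p₂ - 1 := min_le_left _ _
  have h1' : p₁ ≤ centroid f (Set.Iic p₂) - K := min_le_right _ _
  have hlt : p₁ < p₂ := by linarith
  have a1 : p₁ - centroid f (Set.Iic p₁) ≤ K := hf.sub_centroid_Iic_monotone (by linarith)
  have a2 : p₂ - centroid f (Set.Iic p₂) ≤ K := hf.sub_centroid_Iic_monotone h2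
  have a3 := hf.centroid_Iic_lt_centroid_Ioo hlt
  have a4 := hf.centroid_univ_lt_centroid_Ici p₂
  refine ⟨(p₁, p₂), hlt, h2, ?_⟩
  constructor <;> simp only [lloydStep] <;> linarith

/-- The mirror image of `exists_le_lloydStep`. -/
theorem exists_lloydStep_le (hf : IsRegularDensity f) :
    ∃ q : ℝ × ℝ, q.1 < q.2 ∧ 0 ≤ q.1 ∧ lloydStep f q ≤ q := by
  set K := centroid f (Set.Ici 0) - 0
  set q₁ := max 0 (centroid f Set.univ + K)
  set q₂ := max (q₁ + 1) (centroid f (Set.Ici q₁) + K)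
  have h1 : 0 ≤ q₁ := le_max_left _ _
  have h1' : centroid f Set.univ + K ≤ q₁ := le_max_right _ _
  have h2 : q₁ + 1 ≤ q₂ := le_max_left _ _
  have h2' : centroid f (Set.Ici q₁) + K ≤ q₂ := le_max_right _ _
  have hlt : q₁ < q₂ := by linarith
  have a1 : centroid f (Set.Ici q₁) - q₁ ≤ K := hf.centroid_Ici_sub_antitone h1
  have a2 : centroid f (Set.Ici q₂) - q₂ ≤ K := hf.centroid_Ici_sub_antitone (by linarith)
  have a3 := hf.centroid_Ioo_lt_centroid_Ici hlt
  have a4 := hf.centroid_Iic_lt_centroid_univ q₁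
  refine ⟨(q₁, q₂), hlt, h1, ?_⟩
  constructor <;> simp only [lloydStep] <;> linarith

/-- Starting below its image, the iteration increases to a fixed point. -/
theorem exists_lloydStep_eq (hf : IsRegularDensity f) :
    ∃ z : ℝ × ℝ, z.1 < z.2 ∧ lloydStep f z = z := by
  obtain ⟨p, hp, hp0, hLp⟩ := hf.exists_le_lloydStep
  obtain ⟨q, hq, hq0, hLq⟩ := hf.exists_lloydStep_le
  have hlt := hf.lloyd_fst_lt_snd hp
  have hmono : Monotone (lloyd f p) := monotone_nat_of_le_succ fun n => by
    induction n with
    | zero => exact hLp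
    | succ n ih =>
      rw [lloyd_succ, lloyd_succ f p (n + 1)]
      exact hf.lloydStep_mono (hlt n) (hlt (n + 1)) ih
  have hle : ∀ n, lloyd f p n ≤ q := fun n => by
    induction n with
    | zero => exact ⟨hp.le.trans (hp0.trans hq0), hp0.trans (hq0.trans hq.le)⟩
    | succ n ih =>
      rw [lloyd_succ]
      exact (hf.lloydStep_mono (hlt n) hq ih).trans hLq
  have t1 := tendsto_atTop_ciSup (f := fun n => (lloyd f p n).1) (fun m n h => (hmono h).1)
    ⟨q.1, by rintro _ ⟨n, rfl⟩; exact (hle n).1⟩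
  have t2 := tendsto_atTop_ciSup (f := fun n => (lloyd f p n).2) (fun m n h => (hmono h).2)
    ⟨q.2, by rintro _ ⟨n, rfl⟩; exact (hle n).2⟩
  have ht : Tendsto (lloyd f p) atTop (𝓝 (⨆ n, (lloyd f p n).1, ⨆ n, (lloyd f p n).2)) :=
    t1.prodMk_nhds t2
  set z : ℝ × ℝ := (⨆ n, (lloyd f p n).1, ⨆ n, (lloyd f p n).2)
  have ht' := (tendsto_add_atTop_iff_nat 1).2 ht
  have hz : z.1 < z.2 := hf.fst_lt_snd_of_tendsto_lloyd (φ := id) hp (fun n => (hle n).2) ht'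
  refine ⟨z, hz, tendsto_nhds_unique ?_ ht'⟩
  simp_rw [lloyd_succ]
  exact (hf.continuousAt_lloydStep hz).tendsto.comp ht

theorem eq_of_lloydStep_eq (hf : IsRegularDensity f) (h : τ.1 < τ.2) (h' : τ'.1 < τ'.2)
    (hτ : lloydStep f τ = τ) (hτ' : lloydStep f τ' = τ') : τ = τ' := by
  by_contra hne
  have := hf.dist_lloydStep_lt h h' hne
  rw [hτ, hτ'] at this
  exact lt_irrefl _ this

/-- The orbit of a strictly contracting map with a fixed point converges to it: the distances to
the fixed point decrease, and at a limit point of the orbit a pass does not decrease them. -/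
theorem tendsto_lloyd (hf : IsRegularDensity f) {z : ℝ × ℝ} (hz : z.1 < z.2)
    (hLz : lloydStep f z = z) (h : τ.1 < τ.2) : Tendsto (lloyd f τ) atTop (𝓝 z) := by
  have hlt := hf.lloyd_fst_lt_snd h
  have hanti : Antitone fun n => dist (lloyd f τ n) z := antitone_nat_of_succ_le fun n => by
    rw [lloyd_succ]
    conv_lhs => rw [← hLz]
    exact hf.dist_lloydStep_le (hlt n) hz
  have hlim := tendsto_atTop_ciInf hanti ⟨0, by rintro _ ⟨n, rfl⟩; exact dist_nonneg⟩
  set r := ⨅ n, dist (lloyd f τ n) z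
  have hball : ∀ n, lloyd f τ n ∈ Metric.closedBall z (dist τ z) := fun n => hanti (Nat.zero_le n)
  obtain ⟨w, -, φ, hφ, hw⟩ := (isCompact_closedBall z (dist τ z)).tendsto_subseq
    fun n => hball (n + 1)
  have hM : ∀ n, (lloyd f τ n).2 ≤ z.2 + dist τ z := fun n => by
    have h1 : |(lloyd f τ n).2 - z.2| ≤ dist τ z :=
      (le_max_right |(lloyd f τ n).1 - z.1| _).trans (hball n)
    linarith [le_abs_self ((lloyd f τ n).2 - z.2)]
  have hw' : Tendsto (fun n => lloyd f τ (φ n + 1)) atTop (𝓝 w) := hw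
  have hwlt : w.1 < w.2 := hf.fst_lt_snd_of_tendsto_lloyd h hM hw'
  have hφ1 : Tendsto (fun n => φ n + 1) atTop atTop :=
    (tendsto_add_atTop_nat 1).comp hφ.tendsto_atTop
  have d1 : dist w z = r := tendsto_nhds_unique (hw'.dist tendsto_const_nhds) (hlim.comp hφ1)
  have d2 : dist (lloydStep f w) z = r := by
    refine tendsto_nhds_unique
      (((hf.continuousAt_lloydStep hwlt).tendsto.comp hw').dist tendsto_const_nhds)
      ((hlim.comp ((tendsto_add_atTop_nat 1).comp hφ1)).congr fun n => ?_)
    simp only [Function.comp_apply, lloyd_succ]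
  have hwz : w = z := by
    by_contra hne
    have := hf.dist_lloydStep_lt hwlt hz hne
    rw [hLz, d1, d2] at this
    exact lt_irrefl _ this
  rw [tendsto_iff_dist_tendsto_zero]
  rwa [← d1, hwz, dist_self] at hlim

end IsRegularDensity

theorem IsDensity.setIntegral_Ici_eq {f : ℝ → ℝ} (hf : IsDensity f) (t : ℝ) :
    ∫ y in Set.Ici t, f y = 1 - ∫ y in Set.Iic t, f y := by
  rw [integral_Ici_eq_integral_Ioi, ← hf.2.2, ← intervalIntegral.integral_Iic_add_Ioi
    (b := t) hf.2.1.integrableOn hf.2.1.integrableOn]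
  ring

theorem IsDensity.tendsto_setIntegral_Iic_atTop {f : ℝ → ℝ} (hf : IsDensity f) :
    Tendsto (fun t => ∫ y in Set.Iic t, f y) atTop (𝓝 1) := by
  have := (aecover_Iic tendsto_id).integral_tendsto_of_countably_generated hf.2.1
  rwa [hf.2.2] at this

theorem IsDensity.tendsto_setIntegral_Iic_atBot {f : ℝ → ℝ} (hf : IsDensity f) :
    Tendsto (fun t => ∫ y in Set.Iic t, f y) atBot (𝓝 0) := by
  have h2 := (aecover_Ici tendsto_id).integral_tendsto_of_countably_generated hf.2.1
  rw [hf.2.2] at h2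
  have h3 := (tendsto_const_nhds (x := (1 : ℝ))).sub h2
  rw [sub_self] at h3
  refine h3.congr fun t => ?_
  simp only [id, hf.setIntegral_Ici_eq, sub_sub_cancel]

/-! ### Mean squared error and optimal quantizers -/

theorem Quantizer.measurableSet_region (Φ : Quantizer) (n : Symbol) :
    MeasurableSet (Φ.region n) := by
  cases n
  exacts [measurableSet_Iic, measurableSet_Ioo, measurableSet_Ici]

theorem Quantizer.volume_region_ne_zero (Φ : Quantizer) (n : Symbol) :
    volume (Φ.region n) ≠ 0 := by
  cases n <;> simp [Quantizer.region, Φ.lo_lt_hi]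

theorem Quantizer.apply_of_mem_region (Φ : Quantizer) {y : ℝ} {n : Symbol} (h : y ∈ Φ.region n) :
    Φ.apply y = Φ.center n := by
  rw [Quantizer.apply, (Φ.mem_region_iff y n).1 h]

/-- The quantizer with thresholds `τ` whose center points are the centroids of its regions. -/
def centroidQuantizer (f : ℝ → ℝ) (τ : ℝ × ℝ) (h : τ.1 < τ.2) : Quantizer where
  lo := τ.1
  hi := τ.2
  cMinus := centroid f (Set.Iic τ.1)
  cEmpty := centroid f (Set.Ioo τ.1 τ.2)
  cPlus := centroid f (Set.Ici τ.2)
  lo_lt_hi := h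

/-- With ordered center points, the thresholds halfway between them send every input to a nearest
center point. -/
theorem Quantizer.sq_sub_apply_le {Φ Ψ : Quantizer} (h1 : Φ.cMinus < Φ.cEmpty)
    (h2 : Φ.cEmpty < Φ.cPlus) (hlo : Φ.lo = (Φ.cMinus + Φ.cEmpty) / 2)
    (hhi : Φ.hi = (Φ.cEmpty + Φ.cPlus) / 2) (hM : Ψ.cMinus = Φ.cMinus) (hE : Ψ.cEmpty = Φ.cEmpty)
    (hP : Ψ.cPlus = Φ.cPlus) (y : ℝ) : (y - Φ.apply y) ^ 2 ≤ (y - Ψ.apply y) ^ 2 := by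
  have hΨ : Ψ.apply y = Φ.cMinus ∨ Ψ.apply y = Φ.cEmpty ∨ Ψ.apply y = Φ.cPlus := by
    unfold Quantizer.apply
    cases Ψ.symbol y <;> simp [Quantizer.center, hM, hE, hP]
  have hΦ : ∀ n, Φ.symbol y = n → (y - Φ.center n) ^ 2 ≤ (y - Ψ.apply y) ^ 2 := fun n hn => by
    rw [← Φ.mem_region_iff] at hn
    cases n <;> simp only [Quantizer.region, Set.mem_Iic, Set.mem_Ioo, Set.mem_Ici] at hn <;>
      rcases hΨ with h | h | h <;> rw [h] <;> simp only [Quantizer.center] <;>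
      nlinarith
  exact hΦ _ rfl

namespace IsRegularDensity

variable {f : ℝ → ℝ} {s : Set ℝ} {τ : ℝ × ℝ}

theorem setIntegral_sub_sq_mul (hf : IsRegularDensity f) (hs : MeasurableSet s)
    (hs0 : volume s ≠ 0) (c : ℝ) :
    ∫ y in s, (y - c) ^ 2 * f y = (∫ y in s, y ^ 2 * f y) - centroid f s ^ 2 * (∫ y in s, f y) +
      (∫ y in s, f y) * (c - centroid f s) ^ 2 := by
  have h1 : ∫ y in s, (y - c) ^ 2 * f y =
      ∫ y in s, (y ^ 2 * f y - 2 * c * (y * f y) + c ^ 2 * f y) :=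
    integral_congr_ae (.of_forall fun y => by simp only []; ring)
  have i1 := hf.integrable_sq_mul.integrableOn (s := s)
  have i2 := (hf.integrable_mul.const_mul (2 * c)).integrableOn (s := s)
  have i3 := (hf.integrable.const_mul (c ^ 2)).integrableOn (s := s)
  have hC : ∫ y in s, y * f y = centroid f s * ∫ y in s, f y :=
    (div_mul_cancel₀ _ (hf.mass_pos hs hs0).ne').symm
  have i12 : Integrable (fun y => y ^ 2 * f y - 2 * c * (y * f y)) (volume.restrict s) := i1.sub i2
  rw [h1, integral_add i12 i3, integral_sub i1 i2, integral_const_mul, integral_const_mul,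
    hC]
  ring

theorem integrable_sub_apply_sq_mul (hf : IsRegularDensity f) (Φ : Quantizer) :
    Integrable (fun y => (y - Φ.apply y) ^ 2 * f y) := by
  have hon : ∀ n, IntegrableOn (fun y => (y - Φ.apply y) ^ 2 * f y) (Φ.region n) := fun n =>
    (hf.integrable_sub_sq_mul (Φ.center n)).integrableOn.congr_fun
      (fun y hy => by simp only [Φ.apply_of_mem_region hy]) (Φ.measurableSet_region n)
  have := ((hon .minus).union (hon .empty)).union (hon .plus)
  rw [← integrableOn_univ]
  refine this.mono_set fun y _ => ?_
  have := (Φ.mem_region_iff y _).2 rfl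
  cases h : Φ.symbol y <;> rw [h] at this
  exacts [Or.inl (Or.inl this), Or.inl (Or.inr this), Or.inr this]

theorem mse_eq_sum (hf : IsRegularDensity f) (Φ : Quantizer) :
    mse f Φ = (∫ y in Set.Iic Φ.lo, (y - Φ.cMinus) ^ 2 * f y) +
      (∫ y in Set.Ioo Φ.lo Φ.hi, (y - Φ.cEmpty) ^ 2 * f y) +
      ∫ y in Set.Ici Φ.hi, (y - Φ.cPlus) ^ 2 * f y := by
  have hon : ∀ n, ∫ y in Φ.region n, (y - Φ.apply y) ^ 2 * f y =
      ∫ y in Φ.region n, (y - Φ.center n) ^ 2 * f y := fun n =>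
    setIntegral_congr_fun (Φ.measurableSet_region n)
      fun y hy => by simp only [Φ.apply_of_mem_region hy]
  have hint := hf.integrable_sub_apply_sq_mul Φ
  have e1 := hon .minus
  have e2 := hon .empty
  have e3 := hon .plus
  simp only [Quantizer.region, Quantizer.center] at e1 e2 e3
  rw [← e1, ← e2, ← e3, mse, ← setIntegral_union _ measurableSet_Ioo hint.integrableOn
    hint.integrableOn, Set.Iic_union_Ioo_eq_Iio Φ.lo_lt_hi, ← setIntegral_union _ measurableSet_Ici
    hint.integrableOn hint.integrableOn, Set.Iio_union_Ici, setIntegral_univ]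
  · exact Set.disjoint_left.2 fun x hx hx' =>
      absurd (Set.mem_Iio.1 hx) (not_lt.2 (Set.mem_Ici.1 hx'))
  · exact Set.disjoint_left.2 fun x hx hx' => absurd hx'.1 (not_lt.2 hx)

theorem mse_eq_sum_centroid (hf : IsRegularDensity f) (Φ : Quantizer) :
    mse f Φ = mse f (centroidQuantizer f (Φ.lo, Φ.hi) Φ.lo_lt_hi) +
      ((∫ y in Set.Iic Φ.lo, f y) * (Φ.cMinus - centroid f (Set.Iic Φ.lo)) ^ 2 +
      (∫ y in Set.Ioo Φ.lo Φ.hi, f y) * (Φ.cEmpty - centroid f (Set.Ioo Φ.lo Φ.hi)) ^ 2 +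
      (∫ y in Set.Ici Φ.hi, f y) * (Φ.cPlus - centroid f (Set.Ici Φ.hi)) ^ 2) := by
  rw [hf.mse_eq_sum, hf.mse_eq_sum]
  simp only [centroidQuantizer]
  have v1 : volume (Set.Iic Φ.lo) ≠ 0 := Φ.volume_region_ne_zero .minus
  have v2 : volume (Set.Ioo Φ.lo Φ.hi) ≠ 0 := Φ.volume_region_ne_zero .empty
  have v3 : volume (Set.Ici Φ.hi) ≠ 0 := Φ.volume_region_ne_zero .plus
  rw [hf.setIntegral_sub_sq_mul measurableSet_Iic v1 Φ.cMinus,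
    hf.setIntegral_sub_sq_mul measurableSet_Iic v1 (centroid f _),
    hf.setIntegral_sub_sq_mul measurableSet_Ioo v2 Φ.cEmpty,
    hf.setIntegral_sub_sq_mul measurableSet_Ioo v2 (centroid f _),
    hf.setIntegral_sub_sq_mul measurableSet_Ici v3 Φ.cPlus,
    hf.setIntegral_sub_sq_mul measurableSet_Ici v3 (centroid f _)]
  ring

theorem mse_centroidQuantizer_le (hf : IsRegularDensity f) (Φ : Quantizer) :
    mse f (centroidQuantizer f (Φ.lo, Φ.hi) Φ.lo_lt_hi) ≤ mse f Φ := by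
  have m1 := (hf.mass_pos measurableSet_Iic (Φ.volume_region_ne_zero .minus)).le
  have m2 := (hf.mass_pos measurableSet_Ioo (Φ.volume_region_ne_zero .empty)).le
  have m3 := (hf.mass_pos measurableSet_Ici (Φ.volume_region_ne_zero .plus)).le
  rw [hf.mse_eq_sum_centroid Φ]
  exact le_add_of_nonneg_right (add_nonneg (add_nonneg (mul_nonneg m1 (sq_nonneg _))
    (mul_nonneg m2 (sq_nonneg _))) (mul_nonneg m3 (sq_nonneg _)))

theorem eq_centroidQuantizer_of_isOptimal (hf : IsRegularDensity f) {Φ : Quantizer}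
    (h : IsOptimal f Φ) : Φ = centroidQuantizer f (Φ.lo, Φ.hi) Φ.lo_lt_hi := by
  have m1 := hf.mass_pos measurableSet_Iic (Φ.volume_region_ne_zero .minus)
  have m2 := hf.mass_pos measurableSet_Ioo (Φ.volume_region_ne_zero .empty)
  have m3 := hf.mass_pos measurableSet_Ici (Φ.volume_region_ne_zero .plus)
  have hle := h (centroidQuantizer f (Φ.lo, Φ.hi) Φ.lo_lt_hi)
  rw [hf.mse_eq_sum_centroid Φ] at hle
  have n1 := mul_nonneg m1.le (sq_nonneg (Φ.cMinus - centroid f (Set.Iic Φ.lo)))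
  have n2 := mul_nonneg m2.le (sq_nonneg (Φ.cEmpty - centroid f (Set.Ioo Φ.lo Φ.hi)))
  have n3 := mul_nonneg m3.le (sq_nonneg (Φ.cPlus - centroid f (Set.Ici Φ.hi)))
  have key : ∀ {m x : ℝ}, 0 < m → m * x ^ 2 ≤ 0 → x = 0 := fun {m x} hm hx => by
    by_contra hne
    have : 0 < m * x ^ 2 := by positivity
    linarith
  have e1 := sub_eq_zero.1 (key m1 (x := Φ.cMinus - centroid f (Set.Iic Φ.lo)) (by linarith))
  have e2 := sub_eq_zero.1 (key m2 (x := Φ.cEmpty - centroid f (Set.Ioo Φ.lo Φ.hi)) (by linarith))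
  have e3 := sub_eq_zero.1 (key m3 (x := Φ.cPlus - centroid f (Set.Ici Φ.hi)) (by linarith))
  ext
  exacts [rfl, rfl, e1, e2, e3]

/-- The quantizer that keeps the centroids of the regions of `τ` and moves the thresholds halfway
between them. -/
def midpointQuantizer (hf : IsRegularDensity f) (τ : ℝ × ℝ) (h : τ.1 < τ.2) : Quantizer where
  lo := (lloydStep f τ).1
  hi := (lloydStep f τ).2
  cMinus := centroid f (Set.Iic τ.1)
  cEmpty := centroid f (Set.Ioo τ.1 τ.2)
  cPlus := centroid f (Set.Ici τ.2)
  lo_lt_hi := hf.lloydStep_fst_lt_snd h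

theorem mse_midpointQuantizer_le (hf : IsRegularDensity f) (h : τ.1 < τ.2) :
    mse f (hf.midpointQuantizer τ h) ≤ mse f (centroidQuantizer f τ h) := by
  refine integral_mono (hf.integrable_sub_apply_sq_mul _) (hf.integrable_sub_apply_sq_mul _)
    fun y => mul_le_mul_of_nonneg_right ?_ (hf.pos y).le
  refine Quantizer.sq_sub_apply_le (Φ := hf.midpointQuantizer τ h)
    (Ψ := centroidQuantizer f τ h) ?_ ?_ rfl rfl rfl rfl rfl y
  · exact (hf.centroid_Iic_lt τ.1).trans (hf.lt_centroid_Ioo h)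
  · exact (hf.centroid_Ioo_lt h).trans (hf.lt_centroid_Ici τ.2)

theorem mse_centroidQuantizer_lloydStep_le (hf : IsRegularDensity f) (h : τ.1 < τ.2) :
    mse f (centroidQuantizer f (lloydStep f τ) (hf.lloydStep_fst_lt_snd h)) ≤
      mse f (centroidQuantizer f τ h) :=
  (hf.mse_centroidQuantizer_le (hf.midpointQuantizer τ h)).trans (hf.mse_midpointQuantizer_le h)

/-- The thresholds of an optimal quantizer are a fixed point of the Lloyd-Max map: moving them to
the midpoints of the center points does not lose optimality, so the center points remain centroids,
and the centroid of a half-line determines the half-line. -/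
theorem lloydStep_eq_of_isOptimal (hf : IsRegularDensity f) {Φ : Quantizer} (h : IsOptimal f Φ) :
    lloydStep f (Φ.lo, Φ.hi) = (Φ.lo, Φ.hi) := by
  have hopt : IsOptimal f (hf.midpointQuantizer (Φ.lo, Φ.hi) Φ.lo_lt_hi) := fun Ψ =>
    (hf.mse_midpointQuantizer_le Φ.lo_lt_hi).trans
      ((hf.mse_centroidQuantizer_le Φ).trans (h Ψ))
  have heq := hf.eq_centroidQuantizer_of_isOptimal hopt
  have e1 := congrArg Quantizer.cMinus heq
  have e2 := congrArg Quantizer.cPlus heq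
  exact Prod.ext (hf.centroid_Iic_strictMono.injective e1).symm
    (hf.centroid_Ici_strictMono.injective e2).symm

theorem continuous_setIntegral_Iic (hf : IsRegularDensity f) :
    Continuous fun t => ∫ y in Set.Iic t, f y := by
  have h : (fun t => ∫ y in Set.Iic t, f y) =
      fun t => (∫ y in Set.Iic 0, f y) + ∫ y in (0 : ℝ)..t, f y := by
    ext t
    rw [← intervalIntegral.integral_Iic_sub_Iic hf.integrable.integrableOn
      hf.integrable.integrableOn, add_sub_cancel]
  rw [h]
  exact continuous_const.add (intervalIntegral.continuous_primitive
    (fun _ _ => hf.integrable.intervalIntegrable) 0)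

theorem setIntegral_Ioo_eq (hf : IsRegularDensity f) {a b : ℝ} (h : a < b) :
    ∫ y in Set.Ioo a b, f y = (∫ y in Set.Iic b, f y) - ∫ y in Set.Iic a, f y := by
  rw [integral_Iic_eq_integral_Iio (x := b), ← Set.Iic_union_Ioo_eq_Iio h, setIntegral_union
    (Set.disjoint_left.2 fun x hx hx' => absurd hx'.1 (not_lt.2 (Set.mem_Iic.1 hx)))
    measurableSet_Ioo hf.integrable.integrableOn hf.integrable.integrableOn]
  ring

theorem mse_centroidQuantizer (hf : IsRegularDensity f) (h : τ.1 < τ.2) :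
    mse f (centroidQuantizer f τ h) = (∫ y, y ^ 2 * f y) -
      (centroid f (Set.Iic τ.1) ^ 2 * (∫ y in Set.Iic τ.1, f y) +
      centroid f (Set.Ioo τ.1 τ.2) ^ 2 * ((∫ y in Set.Iic τ.2, f y) - ∫ y in Set.Iic τ.1, f y) +
      centroid f (Set.Ici τ.2) ^ 2 * (1 - ∫ y in Set.Iic τ.2, f y)) := by
  have hsq : (∫ y in Set.Iic τ.1, y ^ 2 * f y) + (∫ y in Set.Ioo τ.1 τ.2, y ^ 2 * f y) +
      ∫ y in Set.Ici τ.2, y ^ 2 * f y = ∫ y, y ^ 2 * f y := by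
    have := hf.mse_eq_sum ⟨τ.1, τ.2, 0, 0, 0, h⟩
    have h0 : ∀ y, (⟨τ.1, τ.2, 0, 0, 0, h⟩ : Quantizer).apply y = 0 := fun y => by
      unfold Quantizer.apply
      cases (⟨τ.1, τ.2, 0, 0, 0, h⟩ : Quantizer).symbol y <;> rfl
    simpa only [mse, h0, sub_zero] using this.symm
  rw [hf.mse_eq_sum, ← hsq]
  simp only [centroidQuantizer]
  rw [hf.setIntegral_sub_sq_mul measurableSet_Iic (by simp),
    hf.setIntegral_sub_sq_mul measurableSet_Ioo (by simpa using h),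
    hf.setIntegral_sub_sq_mul measurableSet_Ici (by simp), hf.isDensity.setIntegral_Ici_eq,
    hf.setIntegral_Ioo_eq h]
  ring

/-- A fixed point of the Lloyd-Max map is optimal: the iteration started at the thresholds of any
competitor converges to it without increasing the mean squared error. -/
theorem isOptimal_of_lloydStep_eq (hf : IsRegularDensity f) {z : ℝ × ℝ} (hz : z.1 < z.2)
    (hLz : lloydStep f z = z) : IsOptimal f (centroidQuantizer f z hz) := by
  intro Ψ
  refine le_trans ?_ (hf.mse_centroidQuantizer_le Ψ)
  set τ : ℝ × ℝ := (Ψ.lo, Ψ.hi)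
  have h : τ.1 < τ.2 := Ψ.lo_lt_hi
  have hdec : ∀ n, mse f (centroidQuantizer f (lloyd f τ n) (hf.lloyd_fst_lt_snd h n)) ≤
      mse f (centroidQuantizer f τ h) := fun n => by
    induction n with
    | zero => exact le_rfl
    | succ n ih =>
      refine le_trans (le_of_eq ?_)
        ((hf.mse_centroidQuantizer_lloydStep_le (hf.lloyd_fst_lt_snd h n)).trans ih)
      simp only [lloyd_succ]
  have hlim := hf.tendsto_lloyd hz hLz h
  have c1 : ContinuousAt (fun τ : ℝ × ℝ => ∫ y in Set.Iic τ.1, f y) z :=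
    (hf.continuous_setIntegral_Iic.comp continuous_fst).continuousAt
  have c2 : ContinuousAt (fun τ : ℝ × ℝ => ∫ y in Set.Iic τ.2, f y) z :=
    (hf.continuous_setIntegral_Iic.comp continuous_snd).continuousAt
  have hcont := (continuousAt_const (y := ∫ y, y ^ 2 * f y)).sub
    (((((hf.continuousAt_centroid_Iic hz).pow 2).mul c1).add
      (((hf.continuousAt_centroid_Ioo hz).pow 2).mul (c2.sub c1))).add
      (((hf.continuousAt_centroid_Ici hz).pow 2).mul (continuousAt_const (y := (1 : ℝ)).sub c2)))
  rw [hf.mse_centroidQuantizer hz]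
  refine le_of_tendsto' (hcont.tendsto.comp hlim) fun n => ?_
  have := hdec n
  rw [hf.mse_centroidQuantizer] at this
  exact this

theorem lloydConverges (hf : IsRegularDensity f) {z : ℝ × ℝ} (hz : z.1 < z.2)
    (hLz : lloydStep f z = z) (h : τ.1 < τ.2) :
    LloydConverges f τ (centroidQuantizer f z hz) := by
  have hlim := hf.tendsto_lloyd hz hLz h
  exact ⟨hf.lloyd_fst_lt_snd h, hlim, (hf.continuousAt_centroid_Iic hz).tendsto.comp hlim,
    (hf.continuousAt_centroid_Ioo hz).tendsto.comp hlim,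
    (hf.continuousAt_centroid_Ici hz).tendsto.comp hlim⟩

theorem lloydStops (hf : IsRegularDensity f) {z : ℝ × ℝ} (hz : z.1 < z.2)
    (hLz : lloydStep f z = z) (h : τ.1 < τ.2) {ε : ℝ} (hε : 0 < ε) : LloydStops f τ ε := by
  have hlim := hf.tendsto_lloyd hz hLz h
  have hd := hlim.dist ((tendsto_add_atTop_iff_nat 1).2 hlim)
  rw [dist_self] at hd
  obtain ⟨n, hn⟩ := (hd.eventually_le_const hε).exists
  exact ⟨n, (le_max_left _ _).trans hn, (le_max_right _ _).trans hn⟩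

theorem exists_unique_optimal (hf : IsRegularDensity f) :
    ∃ Φopt : Quantizer, IsOptimal f Φopt ∧ (∀ Ψ, IsOptimal f Ψ → Ψ = Φopt) ∧
      ∀ τ₀ : ℝ × ℝ, τ₀.1 < τ₀.2 →
        LloydConverges f τ₀ Φopt ∧ ∀ ε : ℝ, 0 < ε → LloydStops f τ₀ ε := by
  obtain ⟨z, hz, hLz⟩ := hf.exists_lloydStep_eq
  refine ⟨centroidQuantizer f z hz, hf.isOptimal_of_lloydStep_eq hz hLz, fun Ψ hΨ => ?_,
    fun τ₀ h => ⟨hf.lloydConverges hz hLz h, fun ε hε => hf.lloydStops hz hLz h hε⟩⟩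
  have heq := hf.eq_of_lloydStep_eq Ψ.lo_lt_hi hz (hf.lloydStep_eq_of_isOptimal hΨ) hLz
  rw [hf.eq_centroidQuantizer_of_isOptimal hΨ]
  simp only [heq]

/-! ### Quantiles -/

theorem strictMono_setIntegral_Iic (hf : IsRegularDensity f) :
    StrictMono fun t => ∫ y in Set.Iic t, f y := fun a b h => by
  have := hf.mass_pos (measurableSet_Ioo (a := a) (b := b)) (by simpa using h)
  rw [hf.setIntegral_Ioo_eq h] at this
  simp only []
  linarith

theorem setIntegral_Iic_quantile (hf : IsRegularDensity f) {p : ℝ} (h0 : 0 < p) (h1 : p < 1) :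
    ∫ y in Set.Iic (quantile f p), f y = p := by
  have htop := hf.isDensity.tendsto_setIntegral_Iic_atTop
  have hbot := hf.isDensity.tendsto_setIntegral_Iic_atBot
  obtain ⟨a, ha⟩ := (hbot.eventually_lt_const h0).exists
  obtain ⟨b, hb⟩ := (htop.eventually_const_lt h1).exists
  obtain ⟨y, hy⟩ := mem_range_of_exists_le_of_exists_ge hf.continuous_setIntegral_Iic ⟨a, ha.le⟩
    ⟨b, hb.le⟩
  have hset : {t | p ≤ ∫ x in Set.Iic t, f x} = Set.Ici y := by
    ext t
    rw [← hy]
    exact hf.strictMono_setIntegral_Iic.le_iff_le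
  rw [quantile, hset, csInf_Ici]
  exact hy

theorem quantile_lt_quantile (hf : IsRegularDensity f) {p q : ℝ} (h0 : 0 < p) (hpq : p < q)
    (h1 : q < 1) : quantile f p < quantile f q := by
  rwa [← hf.strictMono_setIntegral_Iic.lt_iff_lt, hf.setIntegral_Iic_quantile h0 (hpq.trans h1),
    hf.setIntegral_Iic_quantile (h0.trans hpq) h1]

end IsRegularDensity

/-! ### Log-concavity and its strict two-point form -/

theorem LogConcave.mul_le_mul_shift {g : ℝ → ℝ} (hg : LogConcave g) {x y d : ℝ} (hxy : x ≤ y)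
    (hd : 0 < d) : g x * g (y + d) ≤ g (x + d) * g y := by
  obtain ⟨hg0, hg⟩ := hg
  have hD : 0 < y - x + d := by linarith
  -- `x + d` and `y` are the two convex combinations of `x` and `y + d` with these weights.
  set a := (y - x) / (y - x + d) with ha
  set b := d / (y - x + d) with hb
  have ha0 : 0 ≤ a := div_nonneg (by linarith) hD.le
  have hb0 : 0 ≤ b := div_nonneg hd.le hD.le
  have hab : a + b = 1 := by rw [ha, hb, ← add_div, div_self hD.ne']
  have h1 := hg x (y + d) a b ha0 hb0 hab
  have h2 := hg x (y + d) b a hb0 ha0 (by linarith)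
  have e1 : a * x + b * (y + d) = x + d := by rw [ha, hb]; field_simp; ring
  have e2 : b * x + a * (y + d) = y := by rw [ha, hb]; field_simp; ring
  rw [e1] at h1
  rw [e2] at h2
  have split : ∀ {u : ℝ}, 0 ≤ u → u ^ a * u ^ b = u := fun {u} hu => by
    rw [← Real.rpow_add_of_nonneg hu ha0 hb0, hab, Real.rpow_one]
  calc g x * g (y + d) = (g x ^ a * g x ^ b) * (g (y + d) ^ a * g (y + d) ^ b) := by
        rw [split (hg0 _), split (hg0 _)]
    _ = (g x ^ a * g (y + d) ^ b) * (g x ^ b * g (y + d) ^ a) := by ring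
    _ ≤ g (x + d) * g y := mul_le_mul h1 h2
        (mul_nonneg (Real.rpow_nonneg (hg0 _) _) (Real.rpow_nonneg (hg0 _) _)) (hg0 _)

theorem StrictLogConcave.mul_lt_sq {f : ℝ → ℝ} (hf : StrictLogConcave f) (p : ℝ) {e : ℝ}
    (he : e ≠ 0) : f (p - e) * f (p + e) < f p ^ 2 := by
  rcases lt_or_gt_of_ne he with h | h
  · have := @hf (p + e) p (-e) (by linarith) (by linarith)
    rw [add_neg_cancel_right, ← sub_eq_add_neg] at this
    nlinarith
  · have := @hf (p - e) p e (by linarith) h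
    rw [sub_add_cancel] at this
    nlinarith

/-- For a continuous positive function the strict two-point inequality implies log-concavity: if
`log f` were somewhere below a chord, then the minimum of the difference, which is attained, would
contradict the inequality. -/
theorem StrictLogConcave.logConcave {f : ℝ → ℝ} (hf : StrictLogConcave f) (hc : Continuous f)
    (hpos : ∀ y, 0 < f y) : LogConcave f := by
  refine ⟨fun y => (hpos y).le, fun x y a b ha hb hab => ?_⟩
  rcases eq_or_ne x y with rfl | hxy
  · rw [← Real.rpow_add (hpos x), hab, Real.rpow_one, ← add_mul, hab, one_mul]
  set φ : ℝ → ℝ := fun t => Real.log (f t)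
  have hφ : Continuous φ := hc.log fun t => (hpos t).ne'
  set h : ℝ → ℝ := fun s => φ ((1 - s) * x + s * y) - ((1 - s) * φ x + s * φ y) with hh
  have hhc : Continuous h := by fun_prop
  have hmid : ∀ s δ : ℝ, δ ≠ 0 → h (s - δ) + h (s + δ) < 2 * h s := fun s δ hδ => by
    have he : δ * (y - x) ≠ 0 := mul_ne_zero hδ (sub_ne_zero.2 hxy.symm)
    have h1 := hf.mul_lt_sq ((1 - s) * x + s * y) he
    have h2 := Real.log_lt_log (mul_pos (hpos _) (hpos _)) h1
    rw [Real.log_mul (hpos _).ne' (hpos _).ne', Real.log_pow] at h2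
    have e1 : (1 - (s - δ)) * x + (s - δ) * y = (1 - s) * x + s * y - δ * (y - x) := by ring
    have e2 : (1 - (s + δ)) * x + (s + δ) * y = (1 - s) * x + s * y + δ * (y - x) := by ring
    simp only [hh, φ, e1, e2]
    push_cast at h2
    linarith
  obtain ⟨c, hc01, hmin⟩ := (isCompact_Icc (a := (0 : ℝ)) (b := 1)).exists_isMinOn
    ⟨0, by simp⟩ hhc.continuousOn
  have h0 : h 0 = 0 := by simp [hh]
  have h1 : h 1 = 0 := by simp [hh]
  have hc0 : 0 ≤ h c := by
    by_contra! hneg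
    have c0 : 0 < c := lt_of_le_of_ne hc01.1 fun he => by rw [← he, h0] at hneg; simp at hneg
    have c1 : c < 1 := lt_of_le_of_ne hc01.2 fun he => by rw [he, h1] at hneg; simp at hneg
    have hδ : 0 < min c (1 - c) := lt_min c0 (by linarith)
    have d1 := min_le_left c (1 - c)
    have d2 := min_le_right c (1 - c)
    have m1 : h c ≤ h (c - min c (1 - c)) :=
      hmin (Set.mem_Icc.2 ⟨by linarith, by linarith⟩)
    have m2 : h c ≤ h (c + min c (1 - c)) :=
      hmin (Set.mem_Icc.2 ⟨by linarith, by linarith⟩)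
    linarith [hmid c _ hδ.ne']
  have hb0 : 0 ≤ h b := hc0.trans (hmin (Set.mem_Icc.2 ⟨hb, by linarith⟩))
  have ea : 1 - b = a := by linarith
  simp only [hh, φ, ea] at hb0
  rw [Real.rpow_def_of_pos (hpos x), Real.rpow_def_of_pos (hpos y), ← Real.exp_add,
    ← Real.le_log_iff_exp_le (hpos _)]
  linarith

/-! ### The Gaussian density -/

theorem gaussianPDFReal_le (v : ℝ≥0) (x : ℝ) :
    gaussianPDFReal 0 v x ≤ (√(2 * Real.pi * v))⁻¹ := by
  rw [gaussianPDFReal]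
  refine mul_le_of_le_one_right (by positivity) (Real.exp_le_one_iff.2 ?_)
  exact div_nonpos_of_nonpos_of_nonneg (neg_nonpos.2 (sq_nonneg _)) (by positivity)

theorem isRegularDensity_gaussianPDFReal {v : ℝ≥0} (hv : v ≠ 0) :
    IsRegularDensity (gaussianPDFReal 0 v) where
  isDensity := ⟨gaussianPDFReal_nonneg 0 v, integrable_gaussianPDFReal 0 v,
    integral_gaussianPDFReal_eq_one 0 hv⟩
  pos y := gaussianPDFReal_pos 0 v y hv
  continuous := by
    rw [gaussianPDFReal_def]
    fun_prop
  integrable_sq_mul := by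
    have hv' : 0 < (2 * (v : ℝ))⁻¹ := by positivity
    have := (integrable_rpow_mul_exp_neg_mul_sq hv' (s := 2) (by norm_num)).const_mul
      (√(2 * Real.pi * v))⁻¹
    refine this.congr (.of_forall fun y => ?_)
    simp only [gaussianPDFReal, Real.rpow_two, sub_zero, div_eq_mul_inv]
    ring_nf
  strictLogConcave x y d hxy hd := by
    have hC : 0 < (√(2 * Real.pi * v))⁻¹ := by positivity
    have hv' : 0 < 2 * (v : ℝ) := by positivity
    simp only [gaussianPDFReal, sub_zero]
    rw [mul_mul_mul_comm, mul_mul_mul_comm (b := Real.exp (-(x + d) ^ 2 / (2 * v))),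
      ← Real.exp_add, ← Real.exp_add]
    refine mul_lt_mul_of_pos_left (Real.exp_lt_exp.2 ?_) (mul_pos hC hC)
    rw [← add_div, ← add_div]
    exact div_lt_div_of_pos_right (by nlinarith) hv'

/-! ### Convolution with a strictly log-concave kernel -/

theorem IsDensity.not_ae_periodic {g : ℝ → ℝ} (hg : IsDensity g) {d : ℝ} (hd : 0 < d)
    (hper : ∀ᵐ s, g (s + d) = g s) : False := by
  set F : ℝ → ℝ := fun t => ∫ y in Set.Iic t, g y
  have hF : ∀ t, F (t + d) = F t := fun t => by
    have hmp : MeasurePreserving (fun y : ℝ => y + d) := measurePreserving_add_right volume d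
    have h1 := hmp.setIntegral_preimage_emb (MeasurableEquiv.addRight d).measurableEmbedding g
      (Set.Iic (t + d))
    rw [Set.preimage_add_const_Iic, add_sub_cancel_right] at h1
    simp only [F]
    rw [← h1]
    exact setIntegral_congr_ae measurableSet_Iic (hper.mono fun s hs _ => hs)
  have hFn : ∀ (t : ℝ) (n : ℕ), F (t + n * d) = F t := fun t n => by
    induction n with
    | zero => simp
    | succ n ih =>
      rw [← ih, ← hF (t + n * d)]
      congr 1
      push_cast
      ring
  have hF1 : ∀ t, F t = 1 := fun t => by
    have hlim : Tendsto (fun n : ℕ => t + n * d) atTop atTop :=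
      tendsto_atTop_add_const_left _ _ (tendsto_natCast_atTop_atTop.atTop_mul_const hd)
    have := hg.tendsto_setIntegral_Iic_atTop.comp hlim
    exact tendsto_nhds_unique (tendsto_const_nhds.congr fun n => (hFn t n).symm) this
  have h0 : Tendsto F atBot (𝓝 0) := hg.tendsto_setIntegral_Iic_atBot
  have h1 : Tendsto F atBot (𝓝 1) := tendsto_const_nhds.congr fun t => (hF1 t).symm
  exact zero_ne_one (tendsto_nhds_unique h0 h1)

section Convolution

variable {k g : ℝ → ℝ} {C : ℝ}

theorem convolution_apply (k g : ℝ → ℝ) (x : ℝ) : (k ⋆ g) x = ∫ s, k (x - s) * g s :=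
  convolution_eq_swap _

theorem convolution_apply_add (k g : ℝ → ℝ) (x d : ℝ) :
    (k ⋆ g) (x + d) = ∫ s, k (x - s) * g (s + d) := by
  rw [convolution_apply, ← integral_add_right_eq_self _ d]
  refine integral_congr_ae (.of_forall fun s => ?_)
  simp only [add_sub_add_right_eq_sub]

theorem IsRegularDensity.integrable_sub_mul_of_bounded (hk : IsRegularDensity k)
    (hC : ∀ x, k x ≤ C) (hg : Integrable g) (x : ℝ) : Integrable fun s => k (x - s) * g s :=
  hg.bdd_mul (c := C) (hk.continuous.comp (continuous_const.sub continuous_id)).aestronglyMeasurable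
    (.of_forall fun s => by rw [Real.norm_of_nonneg (hk.pos _).le]; exact hC _)

/-- Convolution with a strictly log-concave kernel makes log-concave densities strictly
log-concave. Twice the difference of the two sides is the integral over the plane of a product of
two determinants, `k (x - s) k (y - t) - k (x - t) k (y - s)` and
`g (s + d) g t - g s g (t + d)`, which have the same sign. Were it zero, then the second determinant
would vanish almost everywhere, and integrating it in `t` would show that `g` is periodic. -/
theorem IsRegularDensity.strictLogConcave_convolution (hk : IsRegularDensity k)
    (hC : ∀ x, k x ≤ C) (hg : IsDensity g) (hlc : LogConcave g) : StrictLogConcave (k ⋆ g) := by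
  intro x y d hxy hd
  have hgd : Integrable fun s => g (s + d) := hg.2.1.comp_add_right d
  set D₁ : ℝ × ℝ → ℝ := fun z => k (x - z.1) * k (y - z.2) - k (x - z.2) * k (y - z.1)
  set D₂ : ℝ × ℝ → ℝ := fun z => g (z.1 + d) * g z.2 - g z.1 * g (z.2 + d)
  have hD₁ : ∀ z : ℝ × ℝ, z.1 < z.2 → 0 < D₁ z := fun z hz => by
    have := hk.strictLogConcave (x := x - z.2) (y := y - z.2) (d := z.2 - z.1) (by linarith)
      (by linarith)
    rw [sub_add_sub_cancel, sub_add_sub_cancel] at this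
    exact sub_pos.2 this
  have hD₁' : ∀ z : ℝ × ℝ, z.2 < z.1 → D₁ z < 0 := fun z hz => by
    have := hD₁ z.swap hz
    simp only [D₁, Prod.fst_swap, Prod.snd_swap] at this ⊢
    linarith
  have hD₂ : ∀ z : ℝ × ℝ, z.1 ≤ z.2 → 0 ≤ D₂ z := fun z hz =>
    sub_nonneg.2 (hlc.mul_le_mul_shift hz hd)
  have hD₂' : ∀ z : ℝ × ℝ, z.2 ≤ z.1 → D₂ z ≤ 0 := fun z hz => by
    have := hD₂ z.swap hz
    simp only [D₂, Prod.fst_swap, Prod.snd_swap] at this ⊢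
    linarith
  have hnonneg : ∀ z, 0 ≤ D₁ z * D₂ z := fun z => by
    rcases lt_trichotomy z.1 z.2 with h | h | h
    · exact mul_nonneg (hD₁ z h).le (hD₂ z h.le)
    · exact (mul_eq_zero_of_right _ (le_antisymm (hD₂' z h.ge) (hD₂ z h.le))).ge
    · exact mul_nonneg_of_nonpos_of_nonpos (hD₁' z h).le (hD₂' z h.le)
  have i1 := (hk.integrable_sub_mul_of_bounded hC hgd x).mul_prod
    (hk.integrable_sub_mul_of_bounded hC hg.2.1 y)
  have i2 := (hk.integrable_sub_mul_of_bounded hC hg.2.1 x).mul_prod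
    (hk.integrable_sub_mul_of_bounded hC hgd y)
  have i3 := (hk.integrable_sub_mul_of_bounded hC hgd y).mul_prod
    (hk.integrable_sub_mul_of_bounded hC hg.2.1 x)
  have i4 := (hk.integrable_sub_mul_of_bounded hC hg.2.1 y).mul_prod
    (hk.integrable_sub_mul_of_bounded hC hgd x)
  have hexp : (fun z => D₁ z * D₂ z) = fun z : ℝ × ℝ =>
      (k (x - z.1) * g (z.1 + d)) * (k (y - z.2) * g z.2) -
      (k (x - z.1) * g z.1) * (k (y - z.2) * g (z.2 + d)) -
      (k (y - z.1) * g (z.1 + d)) * (k (x - z.2) * g z.2) +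
      (k (y - z.1) * g z.1) * (k (x - z.2) * g (z.2 + d)) := by
    ext z
    simp only [D₁, D₂]
    ring
  have hint : Integrable (fun z => D₁ z * D₂ z) (volume.prod volume) := by
    rw [hexp]
    exact ((i1.sub i2).sub i3).add i4
  have hval : ∫ z, D₁ z * D₂ z ∂(volume.prod volume) =
      2 * ((k ⋆ g) (x + d) * (k ⋆ g) y - (k ⋆ g) x * (k ⋆ g) (y + d)) := by
    have e1 := integral_add ((i1.sub i2).sub i3) i4
    have e2 := integral_sub (i1.sub i2) i3
    have e3 := integral_sub i1 i2
    simp only [Pi.sub_apply] at e1 e2 e3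
    rw [hexp, e1, e2, e3]
    rw [integral_prod_mul (fun s => k (x - s) * g (s + d)) (fun t => k (y - t) * g t),
      integral_prod_mul (fun s => k (x - s) * g s) (fun t => k (y - t) * g (t + d)),
      integral_prod_mul (fun s => k (y - s) * g (s + d)) (fun t => k (x - t) * g t),
      integral_prod_mul (fun s => k (y - s) * g s) (fun t => k (x - t) * g (t + d)),
      ← convolution_apply_add, ← convolution_apply_add, ← convolution_apply, ← convolution_apply]
    ring
  have hpos : 0 ≤ ∫ z, D₁ z * D₂ z ∂(volume.prod volume) := integral_nonneg hnonneg
  by_contra hcon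
  have hzero : ∫ z, D₁ z * D₂ z ∂(volume.prod volume) = 0 :=
    le_antisymm (by rw [hval]; linarith [not_lt.1 hcon]) hpos
  rw [integral_eq_zero_iff_of_nonneg hnonneg hint] at hzero
  have hae : ∀ᵐ z ∂((volume : Measure ℝ).prod volume),
      g (z.1 + d) * g z.2 = g z.1 * g (z.2 + d) := by
    filter_upwards [hzero] with z hz
    rcases lt_trichotomy z.1 z.2 with h | h | h
    · exact sub_eq_zero.1 ((mul_eq_zero.1 hz).resolve_left (hD₁ z h).ne')
    · rw [h, mul_comm]
    · exact sub_eq_zero.1 ((mul_eq_zero.1 hz).resolve_left (hD₁' z h).ne)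
  refine hg.not_ae_periodic hd ?_
  filter_upwards [Measure.ae_ae_of_ae_prod hae] with s hs
  have := integral_congr_ae hs
  simp only [integral_const_mul] at this
  rwa [integral_add_right_eq_self g d, hg.2.2, mul_one, mul_one] at this

theorem IsRegularDensity.continuous_convolution (hk : IsRegularDensity k)
    (hC : ∀ x, k x ≤ C) (hg : Integrable g) : Continuous (k ⋆ g) := by
  refine BddAbove.continuous_convolution_left_of_integrable _ ⟨C, ?_⟩ hk.continuous hg
  rintro _ ⟨x, rfl⟩
  simp only [Real.norm_of_nonneg (hk.pos x).le]
  exact hC x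

theorem IsRegularDensity.convolution_pos (hk : IsRegularDensity k)
    (hC : ∀ x, k x ≤ C) (hg : IsDensity g) (x : ℝ) : 0 < (k ⋆ g) x := by
  have h1 : 0 < ∫ s, g s := by rw [hg.2.2]; exact one_pos
  rw [integral_pos_iff_support_of_nonneg hg.1 hg.2.1] at h1
  rw [convolution_apply, integral_pos_iff_support_of_nonneg
    (fun s => mul_nonneg (hk.pos _).le (hg.1 s)) (hk.integrable_sub_mul_of_bounded hC hg.2.1 x)]
  convert h1 using 2
  ext s
  simp [(hk.pos _).ne']

theorem IsRegularDensity.logConcave_convolution (hk : IsRegularDensity k)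
    (hC : ∀ x, k x ≤ C) (hg : IsDensity g) (hlc : LogConcave g) : LogConcave (k ⋆ g) :=
  (hk.strictLogConcave_convolution hC hg hlc).logConcave (hk.continuous_convolution hC hg.2.1)
    (hk.convolution_pos hC hg)

theorem IsRegularDensity.integrable_sq_mul_convolution (hk : IsRegularDensity k)
    (hC : ∀ x, k x ≤ C) (hg : IsDensity g) (hg2 : Integrable fun y => y ^ 2 * g y) :
    Integrable fun y => y ^ 2 * (k ⋆ g) y := by
  have hcont := hk.continuous_convolution hC hg.2.1
  have hpos := hk.convolution_pos hC hg
  set L : ℝ →L[ℝ] ℝ →L[ℝ] ℝ := ContinuousLinearMap.lsmul ℝ ℝ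
  have c1 := hk.integrable_sq_mul.integrable_convolution L hg.2.1
  have c2 := hk.integrable.integrable_convolution L hg2
  refine ((c1.add c2).const_mul 2).mono' ((continuous_pow 2).mul hcont).aestronglyMeasurable ?_
  filter_upwards [hk.integrable_sq_mul.ae_convolution_exists L hg.2.1,
    hk.integrable.ae_convolution_exists L hg2, hk.integrable.ae_convolution_exists L hg.2.1]
    with y h1 h2 h3
  rw [Real.norm_of_nonneg (mul_nonneg (sq_nonneg y) (hpos y).le)]
  simp only [Pi.add_apply, convolution_def]
  rw [← integral_const_mul, ← integral_add h1 h2, ← integral_const_mul]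
  refine integral_mono (h3.const_mul _) ((h1.add h2).const_mul 2) fun t => ?_
  simp only [L, ContinuousLinearMap.lsmul_apply, smul_eq_mul]
  have hkg : 0 ≤ k t * g (y - t) := mul_nonneg (hk.pos t).le (hg.1 _)
  nlinarith [mul_nonneg (sq_nonneg (y - 2 * t)) hkg]

theorem IsRegularDensity.convolution (hk : IsRegularDensity k)
    (hC : ∀ x, k x ≤ C) (hg : IsDensity g) (hg2 : Integrable fun y => y ^ 2 * g y)
    (hlc : LogConcave g) : IsRegularDensity (k ⋆ g) where
  isDensity := ⟨fun y => (hk.convolution_pos hC hg y).le,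
    hk.integrable.integrable_convolution _ hg.2.1, by
      rw [integral_convolution _ hk.integrable hg.2.1, hk.isDensity.2.2, hg.2.2]
      simp⟩
  pos := hk.convolution_pos hC hg
  continuous := hk.continuous_convolution hC hg.2.1
  integrable_sq_mul := hk.integrable_sq_mul_convolution hC hg hg2
  strictLogConcave := hk.strictLogConcave_convolution hC hg hlc

end Convolution

/-! ### The density of the quantization error -/

theorem Quantizer.convex_region (Φ : Quantizer) (n : Symbol) : Convex ℝ (Φ.region n) := by
  cases n
  exacts [convex_Iic _, convex_Ioo _ _, convex_Ici _]

theorem errorDensity_eq (Φ : Quantizer) (n : Symbol) (f : ℝ → ℝ) :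
    errorDensity Φ n f = fun q =>
      (Φ.region n).indicator (fun y => f y / ∫ y in Φ.region n, f y) (q + Φ.center n) := by
  ext q
  simp only [errorDensity, Set.indicator]

theorem LogConcave.logConcave_errorDensity {g : ℝ → ℝ} (hg : LogConcave g) (Φ : Quantizer)
    (n : Symbol) : LogConcave (errorDensity Φ n g) := by
  obtain ⟨hg0, hg⟩ := hg
  set m := ∫ y in Φ.region n, g y with hm
  have hm0 : 0 ≤ m := integral_nonneg hg0
  have hnn : ∀ q, 0 ≤ errorDensity Φ n g q := fun q => by
    rw [errorDensity_eq]
    exact Set.indicator_nonneg (fun y _ => div_nonneg (hg0 y) hm0) _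
  refine ⟨hnn, fun x y a b ha hb hab => ?_⟩
  rcases ha.eq_or_lt with rfl | ha'
  · obtain rfl : b = 1 := by linarith
    simp
  rcases hb.eq_or_lt with rfl | hb'
  · obtain rfl : a = 1 := by linarith
    simp
  by_cases hx : x + Φ.center n ∈ Φ.region n
  swap
  · rw [show errorDensity Φ n g x = 0 from if_neg hx, Real.zero_rpow ha'.ne',
      zero_mul]
    exact hnn _
  by_cases hy : y + Φ.center n ∈ Φ.region n
  swap
  · rw [show errorDensity Φ n g y = 0 from if_neg hy, Real.zero_rpow hb'.ne',
      mul_zero]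
    exact hnn _
  have hxy := Φ.convex_region n hx hy ha hb hab
  have e : a * (x + Φ.center n) + b * (y + Φ.center n) = a * x + b * y + Φ.center n := by
    linear_combination Φ.center n * hab
  rw [smul_eq_mul, smul_eq_mul, e] at hxy
  have hle := hg (x + Φ.center n) (y + Φ.center n) a b ha hb hab
  rw [e] at hle
  rw [show errorDensity Φ n g x = g (x + Φ.center n) / m from if_pos hx,
    show errorDensity Φ n g y = g (y + Φ.center n) / m from if_pos hy,
    show errorDensity Φ n g (a * x + b * y) =
      g (a * x + b * y + Φ.center n) / m from if_pos hxy,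
    Real.div_rpow (hg0 _) hm0, Real.div_rpow (hg0 _) hm0, div_mul_div_comm,
    ← Real.rpow_add_of_nonneg hm0 ha hb, hab, Real.rpow_one]
  exact div_le_div_of_nonneg_right hle hm0

namespace IsRegularDensity

variable {f : ℝ → ℝ}

theorem integral_region_pos (hf : IsRegularDensity f) (Φ : Quantizer) (n : Symbol) :
    0 < ∫ y in Φ.region n, f y :=
  hf.mass_pos (Φ.measurableSet_region n) (Φ.volume_region_ne_zero n)

theorem isDensity_errorDensity (hf : IsRegularDensity f) (Φ : Quantizer) (n : Symbol) :
    IsDensity (errorDensity Φ n f) := by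
  have hm := hf.integral_region_pos Φ n
  have hint : Integrable ((Φ.region n).indicator fun y => f y / ∫ y in Φ.region n, f y) :=
    (hf.integrable.div_const _).indicator (Φ.measurableSet_region n)
  rw [errorDensity_eq]
  refine ⟨fun q => Set.indicator_nonneg (fun y _ => div_nonneg (hf.pos y).le hm.le) _,
    hint.comp_add_right _, ?_⟩
  rw [integral_add_right_eq_self ((Φ.region n).indicator fun y => f y / ∫ y in Φ.region n, f y),
    integral_indicator (Φ.measurableSet_region n), integral_div, div_self hm.ne']

theorem integrable_sq_mul_errorDensity (hf : IsRegularDensity f) (Φ : Quantizer) (n : Symbol) :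
    Integrable fun q => q ^ 2 * errorDensity Φ n f q := by
  have hint : Integrable ((Φ.region n).indicator fun y =>
      (y - Φ.center n) ^ 2 * f y / ∫ y in Φ.region n, f y) :=
    ((hf.integrable_sub_sq_mul _).div_const _).indicator (Φ.measurableSet_region n)
  refine (hint.comp_add_right (Φ.center n)).congr (.of_forall fun q => ?_)
  rw [errorDensity_eq]
  by_cases h : q + Φ.center n ∈ Φ.region n <;> simp [h, mul_div_assoc]

end IsRegularDensity

/-- All input densities of the tracking scheme are regular. -/
theorem isRegularDensity_inputDensity {v : ℝ≥0} (hv : v ≠ 0) (Φ : List Symbol → Quantizer)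
    (h : List Symbol) : IsRegularDensity (inputDensity v Φ h) := by
  have hγ := isRegularDensity_gaussianPDFReal hv
  induction h with
  | nil => exact hγ
  | cons n h ih =>
    exact hγ.convolution (gaussianPDFReal_le v) (ih.isDensity_errorDensity _ n)
      (ih.integrable_sq_mul_errorDensity _ n)
      ((ih.strictLogConcave.logConcave ih.continuous ih.pos).logConcave_errorDensity _ n)

/-! ### The increments of the Wiener process -/

section Wiener

variable {Ω : Type*} [MeasurableSpace Ω] {P : Measure Ω} {σ : ℝ≥0} {W : ℝ≥0 → Ω → ℝ}

theorem IsWiener.map_increment (hW : IsWiener σ W P) (hσ : σ ≠ 0) (t₀ T : ℝ≥0) :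
    P.map (fun ω => W (t₀ + T) ω - W t₀ ω) = gaussianReal 0 (σ ^ 2 * T) := by
  have hσ' : (σ : ℝ) ≠ 0 := by exact_mod_cast hσ
  have h := gaussianReal_const_mul ((hW.toIsPreBrownianReal.shift t₀).hasLaw_eval T) (σ : ℝ)
  have e : (fun ω => W (t₀ + T) ω - W t₀ ω) =
      fun ω => (σ : ℝ) * ((σ : ℝ)⁻¹ * W (t₀ + T) ω - (σ : ℝ)⁻¹ * W t₀ ω) := by
    ext ω
    rw [← mul_sub, mul_inv_cancel_left₀ hσ']
  rw [e, h.map_eq, mul_zero]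
  congr 1

theorem IsWiener.map_eval (hW : IsWiener σ W P) (hσ : σ ≠ 0) (T : ℝ≥0) :
    P.map (W T) = gaussianReal 0 (σ ^ 2 * T) := by
  have hσ' : (σ : ℝ) ≠ 0 := by exact_mod_cast hσ
  have h := gaussianReal_const_mul (hW.toIsPreBrownianReal.hasLaw_eval T) (σ : ℝ)
  have e : W T = fun ω => (σ : ℝ) * ((σ : ℝ)⁻¹ * W T ω) := by
    ext ω
    rw [mul_inv_cancel_left₀ hσ']
  rw [e, h.map_eq, mul_zero]
  congr 1

theorem IsWiener.indepFun_increment (hW : IsWiener σ W P) (hσ : σ ≠ 0) (t₀ T : ℝ≥0) :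
    IndepFun (fun ω => W (t₀ + T) ω - W t₀ ω) (fun ω (t : Set.Iic t₀) => W t ω) P := by
  have hσ' : (σ : ℝ) ≠ 0 := by exact_mod_cast hσ
  have h := (hW.toIsPreBrownianReal.indepFun_shift t₀).comp
    (φ := fun x : ℝ≥0 → ℝ => (σ : ℝ) * x T)
    (ψ := fun (x : Set.Iic t₀ → ℝ) t => (σ : ℝ) * x t) (by fun_prop) (by fun_prop)
  convert h using 1
  · ext ω
    simp only [Function.comp_apply]
    rw [← mul_sub, mul_inv_cancel_left₀ hσ']
  · ext ω t
    simp only [Function.comp_apply]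
    rw [mul_inv_cancel_left₀ hσ']

end Wiener

/-! ### Measurability of the tracking scheme -/

/-- Sequences of symbols are discrete. -/
instance : MeasurableSpace (List Symbol) := ⊤

instance : Countable Symbol :=
  Function.Injective.countable (f := fun n : Symbol => match n with
    | .minus => (0 : ℕ)
    | .empty => 1
    | .plus => 2) fun a b h => by cases a <;> cases b <;> simp_all

theorem Quantizer.measurableSet_symbol_eq (Φ : Quantizer) (n : Symbol) :
    MeasurableSet {y | Φ.symbol y = n} := by
  convert Φ.measurableSet_region n using 1
  ext y
  exact (Φ.mem_region_iff y n).symm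

theorem Quantizer.measurable_symbol_cons (Φ : Quantizer) (h : List Symbol) :
    Measurable fun y => Φ.symbol y :: h := by
  refine measurable_to_countable' fun l => ?_
  have : (fun y => Φ.symbol y :: h) ⁻¹' {l} =
      ⋃ n ∈ {n : Symbol | n :: h = l}, {y | Φ.symbol y = n} := by
    ext y
    simp
  rw [this]
  exact MeasurableSet.biUnion (Set.to_countable _) fun n _ => Φ.measurableSet_symbol_eq n

theorem Quantizer.measurable_apply (Φ : Quantizer) : Measurable Φ.apply := by
  have : Φ.apply =
      fun y => if y ≤ Φ.lo then Φ.cMinus else if y < Φ.hi then Φ.cEmpty else Φ.cPlus := by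
    ext y
    unfold Quantizer.apply Quantizer.symbol
    split_ifs <;> rfl
  rw [this]
  exact Measurable.ite measurableSet_Iic measurable_const
    (Measurable.ite measurableSet_Iio measurable_const measurable_const)

section Monitor

variable {Ω : Type*} {W : ℝ≥0 → Ω → ℝ} {T : ℝ≥0} {Φ : List Symbol → Quantizer}

theorem measurable_monitor [MeasurableSpace Ω] (k : ℕ)
    (hW : ∀ j < k, Measurable (W (((j : ℝ≥0) + 1) * T))) : Measurable (monitor W T Φ k) := by
  induction k with
  | zero => exact measurable_const
  | succ k ih =>
    have hm := ih fun j hj => hW j (hj.trans k.lt_succ_self)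
    have hy : Measurable fun ω => W (((k : ℝ≥0) + 1) * T) ω - (monitor W T Φ k ω).2 :=
      (hW k k.lt_succ_self).sub hm.snd
    have h1 : Measurable fun z : List Symbol × ℝ => (Φ z.1).symbol z.2 :: z.1 :=
      measurable_from_prod_countable_right fun l => (Φ l).measurable_symbol_cons l
    have h2 : Measurable fun z : List Symbol × ℝ => (Φ z.1).apply z.2 :=
      measurable_from_prod_countable_right fun l => (Φ l).measurable_apply
    exact (h1.comp (hm.fst.prodMk hy)).prodMk (hm.snd.add (h2.comp (hm.fst.prodMk hy)))

theorem measurable_input [MeasurableSpace Ω] (k : ℕ)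
    (hW : ∀ j < k + 1, Measurable (W (((j : ℝ≥0) + 1) * T))) : Measurable (input W T Φ k) :=
  (hW k k.lt_succ_self).sub
    (measurable_monitor k fun j hj => hW j (hj.trans k.lt_succ_self)).snd

theorem measurableSet_monitor_eq [MeasurableSpace Ω] (k : ℕ)
    (hW : ∀ j < k, Measurable (W (((j : ℝ≥0) + 1) * T))) (h : List Symbol) :
    MeasurableSet {ω | (monitor W T Φ k ω).1 = h} :=
  (measurable_monitor k hW).fst (MeasurableSpace.measurableSet_top (s := {h}))

theorem setOf_monitor_succ_eq (k : ℕ) (n : Symbol) (h : List Symbol) :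
    {ω | (monitor W T Φ (k + 1) ω).1 = n :: h} =
      {ω | (monitor W T Φ k ω).1 = h} ∩ input W T Φ k ⁻¹' (Φ h).region n := by
  ext ω
  simp only [monitor, Set.mem_inter_iff, Set.mem_preimage, Quantizer.mem_region_iff, input]
  constructor
  · intro hω
    obtain ⟨h1, h2⟩ := List.cons.inj hω
    exact ⟨h2, h2 ▸ h1⟩
  · rintro ⟨h1, h2⟩
    have h1' : (monitor W T Φ k ω).1 = h := h1
    show (Φ (monitor W T Φ k ω).1).symbol _ :: (monitor W T Φ k ω).1 = n :: h
    rw [h1', h2]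

theorem input_succ_eq {k : ℕ} {n : Symbol} {h : List Symbol} {ω : Ω}
    (hω : (monitor W T Φ (k + 1) ω).1 = n :: h) :
    input W T Φ (k + 1) ω =
      (W (((k : ℝ≥0) + 1) * T + T) ω - W (((k : ℝ≥0) + 1) * T) ω) +
        (input W T Φ k ω - (Φ h).center n) := by
  have hmem : ω ∈ {ω | (monitor W T Φ (k + 1) ω).1 = n :: h} := hω
  rw [setOf_monitor_succ_eq] at hmem
  have h1 : (monitor W T Φ k ω).1 = h := hmem.1
  have h2 := (Φ h).apply_of_mem_region hmem.2
  have e : (((k + 1 : ℕ) : ℝ≥0) + 1) * T = ((k : ℝ≥0) + 1) * T + T := by push_cast; ring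
  simp only [input] at h2 ⊢
  rw [e]
  simp only [monitor, h1]
  rw [h2]
  ring

end Monitor

/-! ### Conditional laws -/

theorem conv_withDensity_eq_convolution {k g : ℝ → ℝ} {C : ℝ} (hk : IsRegularDensity k)
    (hC : ∀ x, k x ≤ C) (hg : IsDensity g) :
    (volume.withDensity fun y => ENNReal.ofReal (k y)) ∗
      (volume.withDensity fun y => ENNReal.ofReal (g y)) =
        volume.withDensity fun y => ENNReal.ofReal ((k ⋆ g) y) := by
  rw [conv_withDensity_eq_mlconvolution₀ hk.integrable.aemeasurable.ennreal_ofReal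
    hg.2.1.aemeasurable.ennreal_ofReal]
  congr 1
  ext x
  have hint : Integrable fun t => k t * g (x - t) := by
    simpa using (hk.integrable_sub_mul_of_bounded hC hg.2.1 x).comp_sub_left x
  have hconv : (k ⋆ g) x = ∫ t, k t * g (x - t) := rfl
  rw [lconvolution_def, hconv, ofReal_integral_eq_lintegral_ofReal hint
    (.of_forall fun t => mul_nonneg (hk.pos t).le (hg.1 _))]
  refine lintegral_congr fun t => ?_
  rw [← ENNReal.ofReal_mul (hk.pos t).le, neg_add_eq_sub]

section Cond

variable {Ω : Type*} {m mΩ : MeasurableSpace Ω} {P : Measure Ω} {X Y : Ω → ℝ} {f : ℝ → ℝ}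

theorem measure_inter_preimage_of_indep (hind : Indep (MeasurableSpace.comap X inferInstance) m P)
    {F : Set Ω} (hF : MeasurableSet[m] F) {A : Set ℝ} (hA : MeasurableSet A) :
    P (F ∩ X ⁻¹' A) = P (X ⁻¹' A) * P F := by
  rw [Set.inter_comm]
  exact (Indep_iff _ _ P).1 hind _ _ ⟨A, hA, rfl⟩ hF

/-- Conditioning on an event of a `σ`-algebra does not change the law of a variable independent
of it. -/
theorem map_cond_of_indep [IsFiniteMeasure P] (hm : m ≤ mΩ) (hX : Measurable X)
    (hind : Indep (MeasurableSpace.comap X inferInstance) m P) {E : Set Ω}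
    (hE : MeasurableSet[m] E) (hE0 : P E ≠ 0) : (cond P E).map X = P.map X := by
  ext A hA
  rw [Measure.map_apply hX hA, Measure.map_apply hX hA, cond_apply (hm _ hE),
    measure_inter_preimage_of_indep hind hE hA, mul_left_comm,
    ENNReal.inv_mul_cancel hE0 (measure_ne_top P E), mul_one]

theorem indepFun_cond_of_indep [IsFiniteMeasure P] (hm : m ≤ mΩ) (hX : Measurable X)
    (hind : Indep (MeasurableSpace.comap X inferInstance) m P) {E : Set Ω}
    (hE : MeasurableSet[m] E) (hE0 : P E ≠ 0) (hY : Measurable[m] Y) :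
    IndepFun X Y (cond P E) := by
  rw [indepFun_iff_measure_inter_preimage_eq_mul]
  intro A B hA hB
  have hXA : cond P E (X ⁻¹' A) = P (X ⁻¹' A) := by
    rw [← Measure.map_apply hX hA, map_cond_of_indep hm hX hind hE hE0, Measure.map_apply hX hA]
  have hEB : MeasurableSet[m] (E ∩ Y ⁻¹' B) := MeasurableSet.inter hE (hY hB)
  rw [hXA, cond_apply (hm _ hE), cond_apply (hm _ hE), Set.inter_comm (X ⁻¹' A), ← Set.inter_assoc,
    measure_inter_preimage_of_indep hind hEB hA, mul_left_comm]

theorem IsRegularDensity.withDensity_apply_eq (hf : IsRegularDensity f) {s : Set ℝ}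
    (hs : MeasurableSet s) :
    volume.withDensity (fun y => ENNReal.ofReal (f y)) s = ENNReal.ofReal (∫ y in s, f y) := by
  rw [withDensity_apply _ hs, ofReal_integral_eq_lintegral_ofReal hf.integrable.integrableOn
    (.of_forall fun y => (hf.pos y).le)]

theorem measure_preimage_region_ne_zero (hf : IsRegularDensity f) (hY : Measurable Y)
    (hlaw : P.map Y = volume.withDensity fun y => ENNReal.ofReal (f y)) (Φ : Quantizer)
    (n : Symbol) : P (Y ⁻¹' Φ.region n) ≠ 0 := by
  rw [← Measure.map_apply hY (Φ.measurableSet_region n), hlaw,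
    hf.withDensity_apply_eq (Φ.measurableSet_region n)]
  simpa using hf.integral_region_pos Φ n

/-- The law of the quantization error, given the symbol. -/
theorem map_sub_center_cond (hf : IsRegularDensity f) (hY : Measurable Y)
    (hlaw : P.map Y = volume.withDensity fun y => ENNReal.ofReal (f y)) (Φ : Quantizer)
    (n : Symbol) :
    (cond P (Y ⁻¹' Φ.region n)).map (fun ω => Y ω - Φ.center n) =
      volume.withDensity fun q => ENNReal.ofReal (errorDensity Φ n f q) := by
  rw [errorDensity_eq]
  set R := Φ.region n
  set c := Φ.center n
  have hR : MeasurableSet R := Φ.measurableSet_region n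
  have hm : 0 < ∫ y in R, f y := hf.integral_region_pos Φ n
  ext B hB
  have hB' : MeasurableSet ((fun y : ℝ => y - c) ⁻¹' B) := (measurable_id.sub_const c) hB
  have e1 : Y ⁻¹' R ∩ (fun ω => Y ω - c) ⁻¹' B = Y ⁻¹' (R ∩ (fun y => y - c) ⁻¹' B) := rfl
  rw [Measure.map_apply (hY.sub_const c) hB, cond_apply (hY hR), e1, ← Measure.map_apply hY hR,
    ← Measure.map_apply hY (hR.inter hB'), hlaw, hf.withDensity_apply_eq hR,
    withDensity_apply _ (hR.inter hB'), withDensity_apply _ hB, ← lintegral_indicator hB,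
    ← lintegral_sub_right_eq_self (fun q => B.indicator _ q) c,
    ← lintegral_indicator (hR.inter hB'),
    ← lintegral_const_mul _ ((hf.continuous.measurable.ennreal_ofReal).indicator (hR.inter hB'))]
  refine lintegral_congr fun y => ?_
  by_cases h1 : y ∈ R <;> by_cases h2 : y - c ∈ B <;>
    simp only [h1, h2, Set.indicator, Set.mem_inter_iff, Set.mem_preimage, sub_add_cancel, and_self,
      and_true, if_true, if_false, ENNReal.ofReal_zero, mul_zero, and_false]
  rw [ENNReal.ofReal_div_of_pos hm, div_eq_mul_inv, mul_comm]

/-- The law of the sum of an independent increment and the quantization error, given the past and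
the new symbol. -/
theorem map_add_sub_center_cond [IsFiniteMeasure P] {k : ℝ → ℝ} {C : ℝ} (hm : m ≤ mΩ)
    (hX : Measurable X) (hY : Measurable[m] Y)
    (hind : Indep (MeasurableSpace.comap X inferInstance) m P) {E : Set Ω}
    (hE : MeasurableSet[m] E) (hf : IsRegularDensity f)
    (hlaw : (cond P E).map Y = volume.withDensity fun y => ENNReal.ofReal (f y))
    (hk : IsRegularDensity k) (hC : ∀ x, k x ≤ C)
    (hXlaw : P.map X = volume.withDensity fun y => ENNReal.ofReal (k y)) (Φ : Quantizer)
    (n : Symbol) :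
    P (E ∩ Y ⁻¹' Φ.region n) ≠ 0 ∧
      (cond P (E ∩ Y ⁻¹' Φ.region n)).map (fun ω => X ω + (Y ω - Φ.center n)) =
        volume.withDensity fun y => ENNReal.ofReal ((k ⋆ errorDensity Φ n f) y) := by
  have hY' : Measurable Y := hY.mono hm le_rfl
  have hSm : MeasurableSet[m] (Y ⁻¹' Φ.region n) := hY (Φ.measurableSet_region n)
  have hESm : MeasurableSet[m] (E ∩ Y ⁻¹' Φ.region n) := MeasurableSet.inter hE hSm
  have hES0 : P (E ∩ Y ⁻¹' Φ.region n) ≠ 0 := by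
    have := measure_preimage_region_ne_zero hf hY' hlaw Φ n
    rw [cond_apply (hm _ hE)] at this
    exact right_ne_zero_of_mul this
  have hZm : Measurable[m] fun ω => Y ω - Φ.center n :=
    (measurable_id.sub_const (Φ.center n)).comp hY
  have hZlaw := map_sub_center_cond hf hY' hlaw Φ n
  rw [cond_cond_eq_cond_inter (hm _ hE) (hm _ hSm)] at hZlaw
  have : IsProbabilityMeasure (cond P (E ∩ Y ⁻¹' Φ.region n)) := cond_isProbabilityMeasure hES0
  have hsum := (indepFun_cond_of_indep hm hX hind hESm hES0 hZm).map_add_eq_map_conv_map hX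
    (hZm.mono hm le_rfl)
  rw [map_cond_of_indep hm hX hind hESm hES0, hXlaw, hZlaw,
    conv_withDensity_eq_convolution hk hC (hf.isDensity_errorDensity _ n)] at hsum
  exact ⟨hES0, hsum⟩

end Cond

/-- The `σ`-algebra of the process up to the time `t₀`. -/
abbrev past {Ω : Type*} (W : ℝ≥0 → Ω → ℝ) (t₀ : ℝ≥0) : MeasurableSpace Ω :=
  MeasurableSpace.comap (fun ω (t : Set.Iic t₀) => W t ω) MeasurableSpace.pi

theorem past_le {Ω : Type*} [mΩ : MeasurableSpace Ω] {W : ℝ≥0 → Ω → ℝ}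
    (hWm : ∀ t, Measurable (W t)) (t₀ : ℝ≥0) : past W t₀ ≤ mΩ :=
  Measurable.comap_le (measurable_pi_lambda (fun ω (t : Set.Iic t₀) => W t ω) fun t => hWm t)

theorem measurable_past {Ω : Type*} (W : ℝ≥0 → Ω → ℝ) {t t₀ : ℝ≥0} (h : t ≤ t₀) :
    Measurable[past W t₀] (W t) :=
  (measurable_pi_apply (⟨t, h⟩ : Set.Iic t₀)).comp
    (comap_measurable fun ω (t : Set.Iic t₀) => W t ω)

/-- Every sequence of symbols has positive probability, and given it the input has the tracked
density: the next increment of the Wiener process is independent of the symbols and of the current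
input, so the law of the next input is the convolution of its law with that of the quantization
error. -/
theorem IsWiener.map_input_cond {Ω : Type*} [MeasurableSpace Ω] {P : Measure Ω}
    [IsProbabilityMeasure P] {σ T : ℝ≥0} {W : ℝ≥0 → Ω → ℝ} (hσ : σ ≠ 0) (hT : T ≠ 0)
    (hWm : ∀ t, Measurable (W t)) (hW : IsWiener σ W P) (Φ : List Symbol → Quantizer)
    (h : List Symbol) :
    P {ω | (monitor W T Φ h.length ω).1 = h} ≠ 0 ∧
      (cond P {ω | (monitor W T Φ h.length ω).1 = h}).map (input W T Φ h.length) =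
        volume.withDensity fun y => ENNReal.ofReal (inputDensity (σ ^ 2 * T) Φ h y) := by
  have hv : σ ^ 2 * T ≠ 0 := mul_ne_zero (pow_ne_zero 2 hσ) hT
  have hgauss : gaussianReal 0 (σ ^ 2 * T) =
      volume.withDensity fun y => ENNReal.ofReal (gaussianPDFReal 0 (σ ^ 2 * T) y) := by
    rw [gaussianReal_of_var_ne_zero 0 hv, gaussianPDF_def]
  induction h with
  | nil =>
    have huniv : {ω | (monitor W T Φ ([] : List Symbol).length ω).1 = []} = Set.univ :=
      Set.eq_univ_of_forall fun _ => rfl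
    have hin : input W T Φ ([] : List Symbol).length = W T := by
      ext ω
      simp [input, monitor]
    rw [huniv, cond_univ, hin, hW.map_eval hσ, hgauss]
    exact ⟨by simp, rfl⟩
  | cons n h ih =>
    obtain ⟨hE0, hlaw⟩ := ih
    set k := h.length
    set t₀ : ℝ≥0 := ((k : ℝ≥0) + 1) * T with ht₀
    set E := {ω | (monitor W T Φ k ω).1 = h} with hE
    have hf := isRegularDensity_inputDensity hv Φ h
    have hWpast : ∀ j < k + 1, Measurable[past W t₀] (W (((j : ℝ≥0) + 1) * T)) := fun j hj => by
      refine measurable_past W ?_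
      rw [ht₀]
      gcongr
      omega
    have hEm : MeasurableSet[past W t₀] E :=
      @measurableSet_monitor_eq _ W T Φ (past W t₀) k
        (fun j hj => hWpast j (hj.trans k.lt_succ_self)) h
    have hYm : Measurable[past W t₀] (input W T Φ k) :=
      @measurable_input _ W T Φ (past W t₀) k hWpast
    have hind : Indep (MeasurableSpace.comap (fun ω => W (t₀ + T) ω - W t₀ ω) inferInstance)
        (past W t₀) P := (IndepFun_iff_Indep _ _ P).1 (hW.indepFun_increment hσ t₀ T)
    obtain ⟨hES0, hsum⟩ := map_add_sub_center_cond (past_le hWm t₀) ((hWm _).sub (hWm _)) hYm hind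
      hEm hf hlaw (isRegularDensity_gaussianPDFReal hv) (gaussianPDFReal_le _)
      ((hW.map_increment hσ t₀ T).trans hgauss) (Φ h) n
    have hsucc : {ω | (monitor W T Φ (n :: h).length ω).1 = n :: h} =
        E ∩ input W T Φ k ⁻¹' (Φ h).region n := setOf_monitor_succ_eq k n h
    have hES : MeasurableSet (E ∩ input W T Φ k ⁻¹' (Φ h).region n) :=
      (past_le hWm t₀ _ hEm).inter
        (hYm.mono (past_le hWm t₀) le_rfl ((Φ h).measurableSet_region n))
    rw [hsucc]
    refine ⟨hES0, (Measure.map_congr ?_).trans hsum⟩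
    refine (ae_cond_mem hES).mono fun ω hω => ?_
    rw [← hsucc] at hω
    exact input_succ_eq hω

end WienerTracking

end

/-- Sampling a Wiener process with period `T` and tracking it with an arbitrary quantization
strategy `Φ` (hence also with the quantizers found by the Lloyd-Max iteration), the tracked density
is the density of the input given the symbols sent before it, it is log-concave, and the Lloyd-Max
iteration for it, from the terciles as from any other ordered thresholds, converges to the
MSE-optimal three-region quantizer, which is unique. -/
theorem mainTheorem3 {Ω : Type*} [MeasurableSpace Ω] (P : Measure Ω) [IsProbabilityMeasure P]
    (σ T : ℝ≥0) (hσ : 0 < σ) (hT : 0 < T) (W : ℝ≥0 → Ω → ℝ) (hWm : ∀ t, Measurable (W t))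
    (hW : WienerTracking.IsWiener σ W P) :
    -- truncating and shifting preserves log-concavity
    (∀ g : ℝ → ℝ, WienerTracking.IsDensity g → WienerTracking.LogConcave g →
      ∀ (Ψ : WienerTracking.Quantizer) (n : WienerTracking.Symbol),
        WienerTracking.LogConcave (WienerTracking.errorDensity Ψ n g)) ∧
    -- convolution with a Gaussian preserves log-concavity
    (∀ g : ℝ → ℝ, WienerTracking.IsDensity g → WienerTracking.LogConcave g →
      WienerTracking.LogConcave (gaussianPDFReal 0 (σ ^ 2 * T) ⋆ g)) ∧
    -- the input densities of the scheme
    ∀ (Φ : List WienerTracking.Symbol → WienerTracking.Quantizer)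
      (h : List WienerTracking.Symbol) (f : ℝ → ℝ),
      f = WienerTracking.inputDensity (σ ^ 2 * T) Φ h →
      WienerTracking.IsDensity f ∧ (∀ y, 0 < f y) ∧ Integrable (fun y => y ^ 2 * f y) ∧
      (ProbabilityTheory.cond P {ω | (WienerTracking.monitor W T Φ h.length ω).1 = h}).map
          (WienerTracking.input W T Φ h.length) =
        volume.withDensity (fun y => ENNReal.ofReal (f y)) ∧
      WienerTracking.LogConcave f ∧
      WienerTracking.quantile f (1 / 3) < WienerTracking.quantile f (2 / 3) ∧
      ∃ Φopt : WienerTracking.Quantizer,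
        WienerTracking.IsOptimal f Φopt ∧
        (∀ Ψ, WienerTracking.IsOptimal f Ψ → Ψ = Φopt) ∧
        WienerTracking.LloydConverges f
          (WienerTracking.quantile f (1 / 3), WienerTracking.quantile f (2 / 3)) Φopt ∧
        ∀ τ₀ : ℝ × ℝ, τ₀.1 < τ₀.2 →
          WienerTracking.LloydConverges f τ₀ Φopt ∧
          ∀ ε : ℝ, 0 < ε → WienerTracking.LloydStops f τ₀ ε := by
  have hσ' : σ ≠ 0 := hσ.ne'
  have hT' : T ≠ 0 := hT.ne'
  have hv : σ ^ 2 * T ≠ 0 := mul_ne_zero (pow_ne_zero 2 hσ') hT'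
  refine ⟨fun g _ hg Ψ n => hg.logConcave_errorDensity Ψ n, fun g hg hlc =>
    (WienerTracking.isRegularDensity_gaussianPDFReal hv).logConcave_convolution
      (WienerTracking.gaussianPDFReal_le _) hg hlc, ?_⟩
  rintro Φ h f rfl
  have hf := WienerTracking.isRegularDensity_inputDensity hv Φ h
  have hq := hf.quantile_lt_quantile (p := 1 / 3) (q := 2 / 3) (by norm_num) (by norm_num)
    (by norm_num)
  obtain ⟨Φopt, hopt, huniq, hconv⟩ := hf.exists_unique_optimal
  exact ⟨hf.isDensity, hf.pos, hf.integrable_sq_mul, (hW.map_input_cond hσ' hT' hWm Φ h).2,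
    hf.strictLogConcave.logConcave hf.continuous hf.pos, hq, Φopt, hopt, huniq, (hconv _ hq).1,
    hconv⟩
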